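/- A digraph here is a finite directed graph without parallel arcs, in which digons (pairs of opposite arcs $(u,v),(v,u)$) are allowed. The underlying graph $G$ of a digraph $D$ is the multigraph obtained by forgetting the orientations of the arcs, so a digon gives two parallel edges. $D$ is $\ell$-edge-connected if removing any set of at most $\ell-1$ edges from $G$ leaves a connected graph, and $D$ is $k$-arc-strong if removing any set of at most $k-1$ arcs from $D$ leaves a strongly connected digraph. The inversion of a vertex set $S$ reverses the direction of every arc with both ends in $S$. For a set $S$ of vertices, $d_G(S)$ is the number of edges of $G$ with exactly one end in $S$, and $d_D^+(S)$ is the number of arcs of $D$ going from $S$ to $V(D)\setminus S$. For $k\ge 1$, a digraph $D$ with underlying graph $G$ is a $k$-obstruction if its vertex set admits a partition $(X_1,\dots,X_r,Y)$ into non-empty parts such that, for $X=\bigcup_{i=1}^r X_i$: (i) $d_G(X_i)=2k$ for every $i\in\{1,\dots,r\}$; (ii) for every $x\in X$ and $y\in Y$, there is exactly one edge between $x$ and $y$ in $G$; (iii) $d_D^+(X)-\tfrac12|X|\cdot|Y|$ is an odd integer. Theorem. Let $k$ be a positive integer, let $p\ge 3$ be an odd integer, and let $D$ be a $2k$-edge-connected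 digraph of order $n\ge\max\{p+2,4k+2\}$. Then $D$ can be made $k$-arc-strong by successively applying inversions of vertex sets of size exactly $p$ if and only if $D$ is not a $k$-obstruction. -/

import Mathlib

/-!
Digraphs are Mathlib's `Digraph V`: an arc is a pair `(u, v)` with `D.Adj u v`, so that there are no
parallel arcs while digons (both `(u, v)` and `(v, u)`) are allowed.
Multigraphs are Mathlib's `Graph V E`.
-/

namespace Inversions

open scoped Graph

section Undirected

/-- A multigraph is connected if any two of its vertices are joined by a walk. -/
def Connected {V E : Type*} (G : Graph V E) : Prop :=
  ∀ u ∈ V(G), ∀ v ∈ V(G), Relation.ReflTransGen G.Adj u v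

/-- A multigraph is `k`-edge-connected if the removal of any set of fewer than `k` edges yields a
connected multigraph. -/
def EdgeConnected {V E : Type*} (G : Graph V E) (k : ℕ) : Prop :=
  ∀ F : Finset E, (F : Set E) ⊆ E(G) → F.card < k → Connected (G.deleteEdges (F : Set E))

/-- The cut of `S`: the set of edges with one end in `S` and the other end outside `S`. -/
def cut {V E : Type*} (G : Graph V E) (S : Set V) : Set E :=
  {e | ∃ u ∈ S, ∃ v ∉ S, G.IsLink e u v}

/-- The size of the cut of `S`. -/
noncomputable def cutSize {V E : Type*} (G : Graph V E) (S : Set V) : ℕ :=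
  (cut G S).ncard

end Undirected

section Directed

/-- The underlying multigraph of a digraph: every arc `(u, v)` becomes one edge with ends `u`, `v`.
In particular a digon gives two parallel edges. -/
def underlyingGraph {V : Type*} (D : Digraph V) : Graph V (V × V) where
  vertexSet := Set.univ
  IsLink a u v := D.Adj a.1 a.2 ∧ (a = (u, v) ∨ a = (v, u))
  isLink_symm := fun _ _ => ⟨fun _ _ h => ⟨h.1, h.2.symm⟩⟩
  eq_or_eq_of_isLink_of_isLink := by
    rintro ⟨a, b⟩ x y v w ⟨-, h⟩ ⟨-, h'⟩
    simp only [Prod.mk.injEq] at h h'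
    grind
  left_mem_of_isLink := fun _ _ _ _ => Set.mem_univ _

/-- A digraph is `k`-edge-connected if its underlying multigraph is. -/
def DigraphEdgeConnected {V : Type*} (D : Digraph V) (k : ℕ) : Prop :=
  EdgeConnected (underlyingGraph D) k

/-- The set of arcs of a digraph. -/
def arcSet {V : Type*} (D : Digraph V) : Set (V × V) :=
  {a | D.Adj a.1 a.2}

/-- The digraph obtained by removing a set of arcs. -/
def deleteArcs {V : Type*} (D : Digraph V) (F : Set (V × V)) : Digraph V where
  Adj u v := D.Adj u v ∧ (u, v) ∉ F

/-- A digraph is strongly connected if there is a directed walk from every vertex to every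
vertex. -/
def StronglyConnected {V : Type*} (D : Digraph V) : Prop :=
  ∀ u v : V, Relation.ReflTransGen D.Adj u v

/-- A digraph is `k`-arc-strong if the removal of any set of fewer than `k` arcs yields a strongly
connected digraph. -/
def ArcStrong {V : Type*} (D : Digraph V) (k : ℕ) : Prop :=
  ∀ F : Finset (V × V), (F : Set (V × V)) ⊆ arcSet D → F.card < k →
    StronglyConnected (deleteArcs D (F : Set (V × V)))

/-- The number `d⁺(S)` of arcs going from `S` to the complement of `S`. -/
noncomputable def outDegree {V : Type*} (D : Digraph V) (S : Set V) : ℕ :=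
  {a ∈ arcSet D | a.1 ∈ S ∧ a.2 ∉ S}.ncard

/-- The inversion of `X`: all arcs with both ends in `X` are reversed. -/
def invert {V : Type*} (D : Digraph V) (X : Finset V) : Digraph V where
  Adj u v := ((u ∈ X ∧ v ∈ X) ∧ D.Adj v u) ∨ (¬ (u ∈ X ∧ v ∈ X) ∧ D.Adj u v)

/-- The digraph obtained by inverting the members of a list of sets one after another. -/
def invertAll {V : Type*} (D : Digraph V) (L : List (Finset V)) : Digraph V :=
  L.foldl invert D

/-- `D` can be made `k`-arc-strong by inversions of size exactly `p`. -/
def Invertible {V : Type*} (k p : ℕ) (D : Digraph V) : Prop :=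
  ∃ L : List (Finset V), (∀ X ∈ L, X.card = p) ∧ ArcStrong (invertAll D L) k

/-- `D` is a `k`-obstruction: there is a partition of the vertex set into non-empty parts
`P 0, …, P (r - 1), Y` satisfying the three conditions, where `X` is the union of the `P i`. -/
def IsObstruction {V : Type*} (k : ℕ) (D : Digraph V) : Prop :=
  ∃ (r : ℕ) (P : Fin r → Set V) (X Y : Set V),
    (∀ i, (P i).Nonempty) ∧ Y.Nonempty ∧
    (∀ i j, i ≠ j → Disjoint (P i) (P j)) ∧
    X = ⋃ i, P i ∧ Disjoint X Y ∧ X ∪ Y = Set.univ ∧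
    (∀ i, cutSize (underlyingGraph D) (P i) = 2 * k) ∧
    (∀ x ∈ X, ∀ y ∈ Y, ∃! e, (underlyingGraph D).IsLink e x y) ∧
    ∃ m : ℤ, Odd m ∧ (outDegree D X : ℚ) - (X.ncard : ℚ) * (Y.ncard : ℚ) / 2 = (m : ℚ)

end Directed

end Inversions

/-! Necessity is a parity argument. For odd `p`, a set of size `p` has an even number of pairs
across any cut. Hence, if every pair leaving `X` carries exactly one arc, inversions preserve the
parity of `d⁺(X)`. In a `k`-arc-strong reorientation a set with cut size `2k` has exactly `k` arcs
out and `k` in. Summing over the `X_i` gives `d⁺(X) = |X||Y|/2`, which contradicts condition (iii)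
(`not_solvable_of_isObstruction`).

For sufficiency, large cuts yield some `k`-arc-strong reorientation with the same digons. This is
Nash-Williams' weak orientation theorem, proved by rounding a half-integral orientation
(`LargeCuts.exists_strong`). Record the reversed pairs as a vector `f` over `ZMod 2`; the aim is to
bring `f` into the span of the cliques of size `p`. This span contains all 4-cycles, so modulo it a
pair `ab` equals `T + q a + q b` for a fixed `T` and a potential `q` (`exists_potential`). Pairs
with no arc or a digon are free: flipping them changes nothing. Deleting arcs creates more free
pairs, and is allowed while all cuts keep `2k` edges (`solvable_of_mem_sup`).

If the free pairs connect all vertices, `f` has class `0` or `T`. Class `T` is repaired by one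
further change of class `T` inside a tournament on `k + 2` vertices: reversing a directed triangle,
or the arc from source to sink (`Strong.exists_flip`). If they do not connect all vertices but the
vertices split into groups none of which is too large, deletions make them connected
(`solvable_of_groups`). Otherwise one component `C` misses at most `2k` vertices. Either an arc
leaving `C` can be deleted, or `C` is partitioned into sets of cut size `2k`. In the latter case `D`
not being an obstruction means that `f` crosses `C` evenly, and the potential difference across `C`
cancels (`solvable_of_component`). -/

namespace Inversions

open Finset
open scoped Classical

set_option linter.unusedSectionVars false

/-! ### Weighted cuts and submodularity. -/

section Cuts

variable {V : Type*} [Fintype V]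

/-- The total weight of the ordered pairs leaving `Z`. -/
noncomputable def cutWeight (x : V → V → ℤ) (Z : Finset V) : ℤ :=
  ∑ u, ∑ v, if u ∈ Z ∧ v ∉ Z then x u v else 0

/-- The nonempty proper subsets of the vertex set. -/
def Proper (Z : Finset V) : Prop := Z.Nonempty ∧ Z ≠ univ

lemma proper_of_mem {Z : Finset V} {u v : V} (hu : u ∈ Z) (hv : v ∉ Z) : Proper Z :=
  ⟨⟨u, hu⟩, fun h => hv (h ▸ mem_univ v)⟩

lemma Proper.exists_notMem {Z : Finset V} (h : Proper Z) : ∃ v, v ∉ Z := by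
  by_contra! hc
  exact h.2 (eq_univ_iff_forall.2 hc)

lemma Proper.compl {Z : Finset V} (h : Proper Z) : Proper Zᶜ := by
  obtain ⟨v, hv⟩ := h.exists_notMem
  obtain ⟨u, hu⟩ := h.1
  exact proper_of_mem (u := v) (v := u) (by simpa) (by simpa)

lemma cutWeight_submodular {x : V → V → ℤ} (hx : ∀ u v, 0 ≤ x u v) (A B : Finset V) :
    cutWeight x (A ∩ B) + cutWeight x (A ∪ B) ≤ cutWeight x A + cutWeight x B := by
  simp only [cutWeight, ← sum_add_distrib]
  refine sum_le_sum fun u _ => sum_le_sum fun v _ => ?_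
  have := hx u v
  by_cases h1 : u ∈ A <;> by_cases h2 : u ∈ B <;> by_cases h3 : v ∈ A <;> by_cases h4 : v ∈ B <;>
    simp [h1, h2, h3, h4, this]

lemma cutWeight_compl (x : V → V → ℤ) (Z : Finset V) :
    cutWeight x Zᶜ = cutWeight (fun u v => x v u) Z := by
  simp only [cutWeight]
  rw [sum_comm]
  refine sum_congr rfl fun u _ => sum_congr rfl fun v _ => ?_
  simp [and_comm]

lemma cutWeight_add (x y : V → V → ℤ) (Z : Finset V) :
    cutWeight (fun u v => x u v + y u v) Z = cutWeight x Z + cutWeight y Z := by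
  simp only [cutWeight, ← sum_add_distrib]
  refine sum_congr rfl fun u _ => sum_congr rfl fun v _ => ?_
  split_ifs <;> simp

lemma cutWeight_const_mul (c : ℤ) (x : V → V → ℤ) (Z : Finset V) :
    cutWeight (fun u v => c * x u v) Z = c * cutWeight x Z := by
  simp only [cutWeight, mul_sum]
  refine sum_congr rfl fun u _ => sum_congr rfl fun v _ => ?_
  split_ifs <;> simp

lemma cutWeight_mono {x y : V → V → ℤ} {Z : Finset V} (h : ∀ u ∈ Z, ∀ v ∉ Z, x u v ≤ y u v) :
    cutWeight x Z ≤ cutWeight y Z := by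
  refine sum_le_sum fun u _ => sum_le_sum fun v _ => ?_
  split_ifs with h'
  · exact h u h'.1 v h'.2
  · rfl

lemma cutWeight_congr {x y : V → V → ℤ} {Z : Finset V} (h : ∀ u ∈ Z, ∀ v ∉ Z, x u v = y u v) :
    cutWeight x Z = cutWeight y Z :=
  le_antisymm (cutWeight_mono fun u hu v hv => (h u hu v hv).le)
    (cutWeight_mono fun u hu v hv => (h u hu v hv).ge)

/-- The difference of the weights leaving and entering a set is additive over its vertices. -/
lemma cutWeight_sub_compl (x : V → V → ℤ) (Z : Finset V) :
    cutWeight x Z - cutWeight x Zᶜ = ∑ u ∈ Z, ∑ v, (x u v - x v u) := by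
  have h : ∑ u ∈ Z, ∑ v ∈ Z, (x u v - x v u) = 0 := by
    simp only [sum_sub_distrib]
    rw [sum_comm (f := fun u v => x v u), sub_self]
  have h' : ∀ u, ∑ v, (x u v - x v u) =
      ∑ v ∈ Z, (x u v - x v u) + ∑ v ∈ Zᶜ, (x u v - x v u) := fun u =>
    (sum_add_sum_compl Z _).symm
  simp only [h', sum_add_distrib, h, zero_add]
  rw [cutWeight_compl]
  simp only [cutWeight, ← sum_sub_distrib]
  rw [← sum_filter_add_sum_filter_not univ (· ∈ Z)]
  rw [sum_eq_zero (s := univ.filter (· ∉ Z)), add_zero]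
  · refine sum_congr (by ext; simp) fun u hu => ?_
    have hu : u ∈ Z := by simpa using hu
    rw [← sum_filter_add_sum_filter_not univ (· ∉ Z)]
    rw [sum_eq_zero (s := univ.filter (fun v => ¬ v ∉ Z)), add_zero]
    · refine sum_congr (by ext; simp) fun v hv => ?_
      have hv : v ∉ Z := by simpa using hv
      simp [hu, hv]
    · intro v hv
      have hv : v ∈ Z := by simpa using hv
      simp [hv]
  · intro u hu
    have hu : u ∉ Z := by simpa using hu
    simp [hu]

/-! ### Simultaneous exchanges without shortcuts. -/

section Exchange

/-- Moving one unit from `u` to `v` is not blocked by a set on which `s` vanishes. -/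
def Exchangeable (s : Finset V → ℤ) (u v : V) : Prop := ∀ Z, s Z = 0 → u ∈ Z → v ∈ Z

/-- The indicator of a set as an integer. -/
noncomputable def ind (Z : Finset V) (v : V) : ℤ := if v ∈ Z then 1 else 0

lemma Exchangeable.trans {s : Finset V → ℤ} {u v z : V} (h : Exchangeable s u v)
    (h' : Exchangeable s v z) : Exchangeable s u z := fun Z hZ hu => h' Z hZ (h Z hZ hu)

lemma ind_inter_add_union (A B : Finset V) (v : V) :
    ind (A ∩ B) v + ind (A ∪ B) v = ind A v + ind B v := by
  by_cases h : v ∈ A <;> by_cases h' : v ∈ B <;> simp [ind, h, h']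

/-- Exchanges can be carried out simultaneously if there are no shortcuts. -/
lemma exchange_simultaneously (u v : ℕ → V) (r : ℕ) : ∀ s : Finset V → ℤ,
    (∀ A B : Finset V, (A ∩ B).Nonempty → A ∪ B ≠ univ →
      s (A ∩ B) + s (A ∪ B) ≤ s A + s B) →
    (∀ Z, Proper Z → 0 ≤ s Z) →
    (∀ i < r, Exchangeable s (u i) (v i)) →
    (∀ j < r, ∀ i < j, ¬ Exchangeable s (u i) (v j)) →
    ∀ Z, Proper Z → 0 ≤ s Z + ∑ i ∈ range r, (ind Z (v i) - ind Z (u i)) := by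
  induction r with
  | zero => intro s _ h _ _ Z hZ; simpa using h Z hZ
  | succ r ih =>
    intro s hsub hpos hex hno Z hZ
    have hpos' : ∀ Z, u r ∈ Z → v r ∉ Z → 1 ≤ s Z := by
      intro Z h1 h2
      have h0 := hpos Z (proper_of_mem h1 h2)
      have : s Z ≠ 0 := fun h => h2 (hex r (by omega) Z h h1)
      omega
    -- The last exchange is carried out first; the other exchanges must stay admissible and free of
    -- shortcuts for the modified function.
    have key := ih (fun Z => s Z + (ind Z (v r) - ind Z (u r))) ?_ ?_ ?_ ?_ Z hZ
    · rw [sum_range_succ]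
      linarith
    · intro A B h1 h2
      have := hsub A B h1 h2
      have h3 := ind_inter_add_union A B (v r)
      have h4 := ind_inter_add_union A B (u r)
      linarith
    · intro Z hZ
      have h0 := hpos Z hZ
      have h1 := hpos' Z
      dsimp only [ind]
      split_ifs with h2 h3 h3
      · omega
      · omega
      · have := h1 h3 h2; omega
      · omega
    · intro i hi Z h0 hu
      by_contra hv
      have hne : s Z ≠ 0 := fun h => hv (hex i (by omega) Z h hu)
      have hge := hpos Z (proper_of_mem hu hv)
      obtain ⟨h1, h2, h3⟩ : u r ∈ Z ∧ v r ∉ Z ∧ s Z = 1 := by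
        dsimp only [ind] at h0
        split_ifs at h0 with h2 h3 h3
        · omega
        · omega
        · exact ⟨h3, h2, by omega⟩
        · omega
      -- Uncross `Z` with a tight `W` containing `u i` but not `v r`: `Z ∩ W` separates `u i` from
      -- `v i` and `Z ∪ W` separates `u r` from `v r`, so both values are at least `1`, while their
      -- sum is at most `1`.
      have hb := hno r (by omega) i hi
      simp only [Exchangeable, not_forall] at hb
      obtain ⟨W, hW, huW, hvW⟩ := hb
      have hs := hsub Z W ⟨u i, by simp [hu, huW]⟩ (fun h => by
        have := mem_univ (v r)
        rw [← h] at this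
        simp [h2, hvW] at this)
      have ha := hpos (Z ∩ W) (proper_of_mem (u := u i) (v := v i) (by simp [hu, huW])
        (by simp [hv]))
      have ha' : s (Z ∩ W) ≠ 0 := fun h => by
        have := hex i (by omega) _ h (by simp [hu, huW])
        simp [hv] at this
      have hb := hpos' (Z ∪ W) (by simp [h1]) (by simp [h2, hvW])
      omega
    · intro j hj i hi hE
      have h1 := hno j (by omega) i hi
      have h2 := hno r (by omega) i (by omega)
      simp only [Exchangeable, not_forall] at h1 h2
      obtain ⟨Z, hZ, huZ, hvZ⟩ := h1
      obtain ⟨W, hW, huW, hvW⟩ := h2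
      have hs := hsub Z W ⟨u i, by simp [huZ, huW]⟩
      -- If `u r ∈ Z`, the exchange leaves the value on `Z` unchanged and `Z` still blocks.
      -- Otherwise `Z ∩ W` is tight and contains neither `u r` nor `v r`, so it blocks.
      by_cases hr : u r ∈ Z
      · have hr' : v r ∈ Z := hex r (by omega) Z hZ hr
        exact hvZ (hE Z (by simp [ind, hr, hr', hZ]) huZ)
      have hrW : u r ∉ W := fun h => hvW (hex r (by omega) W hW h)
      have hs := hs (fun h => by
        have := mem_univ (u r)
        rw [← h] at this
        simp [hr, hrW] at this)
      have ha := hpos (Z ∩ W) (proper_of_mem (u := u i) (v := v j) (by simp [huZ, huW])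
        (by simp [hvZ]))
      have hb := hpos (Z ∪ W) (proper_of_mem (u := u i) (v := u r) (by simp [huZ])
        (by simp [hr, hrW]))
      have hz : s (Z ∩ W) = 0 := by omega
      have := hE (Z ∩ W) (by simp [ind, hr, hvW, hz]) (by simp [huZ, huW])
      exact hvZ (mem_inter.1 this).1

end Exchange

/-! ### Rounding half-integral orientations. -/

/-- A relation on a finite type in which every state has a successor has a shortest cycle. -/
lemma exists_shortest_cycle {σ : Type*} [Finite σ] (T : σ → σ → Prop) {F : σ → Prop}
    (h : ∀ s, F s → ∃ s', F s' ∧ T s s') {s₀ : σ} (h₀ : F s₀) :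
    ∃ r, 1 ≤ r ∧ ∃ t : ℕ → σ, t r = t 0 ∧ (∀ i < r, T (t i) (t (i + 1))) ∧
      ∀ i j, i ≤ j → j < r → j - i + 1 < r → ¬ T (t j) (t i) := by
  have hex : ∃ r, 1 ≤ r ∧ ∃ t : ℕ → σ, t r = t 0 ∧ ∀ i < r, T (t i) (t (i + 1)) := by
    choose g hg using h
    let t : ℕ → {s // F s} := fun n => (fun s => ⟨g s.1 s.2, (hg s.1 s.2).1⟩)^[n] ⟨s₀, h₀⟩
    have ht : ∀ n, T (t n).1 (t (n + 1)).1 := by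
      intro n
      simp only [t, Function.iterate_succ_apply']
      exact (hg _ _).2
    have hni := not_injective_infinite_finite t
    simp only [Function.Injective, not_forall] at hni
    obtain ⟨m, n, hmn, hne⟩ := hni
    wlog hlt : m < n generalizing m n
    · exact this n m hmn.symm (Ne.symm hne) (by omega)
    refine ⟨n - m, by omega, fun i => (t (m + i)).1, ?_, fun i _ => ht _⟩
    simp [show m + (n - m) = n by omega, hmn]
  obtain ⟨hr, t, ht0, ht⟩ := Nat.find_spec hex
  refine ⟨Nat.find hex, hr, t, ht0, ht, fun i j hij hj hlt hT => ?_⟩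
  -- A chord from `t j` back to `t i` closes the segment between them into a shorter cycle.
  refine Nat.find_min hex hlt ⟨by omega, fun l => if l = j - i + 1 then t i else t (i + l), ?_, ?_⟩
  · simp
  · intro l hl
    dsimp only
    rw [if_neg (by omega)]
    split_ifs with h1
    · rwa [show i + l = j by omega]
    · exact ht _ (by omega)

lemma sum_sum_symm_eq_zero {φ : V → V → ZMod 2} (hs : ∀ u v, φ u v = φ v u) (hd : ∀ u, φ u u = 0)
    (Z : Finset V) : ∑ u ∈ Z, ∑ v ∈ Z, φ u v = 0 := by
  rw [← sum_product']
  refine sum_involution (fun a _ => a.swap) ?_ ?_ ?_ ?_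
  · rintro ⟨a, b⟩ _
    simp only [Prod.swap]
    rw [hs b a]
    exact CharTwo.add_self_eq_zero _
  · rintro ⟨a, b⟩ _ h1 h2
    simp only [Prod.swap, Prod.mk.injEq] at h2
    exact h1 (by rw [← h2.1]; exact hd _)
  · rintro ⟨a, b⟩ h
    simpa [and_comm] using h
  · rintro ⟨a, b⟩ _
    rfl

/-- `x / 2` is a fractional orientation of the multigraph given by `w` in which at least `k` units
leave every proper set. -/
def HalfOrientation (w : V → V → ℤ) (k : ℕ) (x : V → V → ℤ) : Prop :=
  (∀ u v, 0 ≤ x u v ∧ x u v ≤ 2 ∧ x u v + x v u = 2 * (w u v + w v u)) ∧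
    ∀ Z, Proper Z → 2 * (k : ℤ) ≤ cutWeight x Z

section Rounding

variable {w x : V → V → ℤ} {k : ℕ}

lemma HalfOrientation.symm (h : HalfOrientation w k x) {u v : V} (hx : x u v = 1) :
    x v u = 1 := by
  have h1 := h.1 u v
  have h2 := h.1 v u
  omega

lemma HalfOrientation.submodular (h : HalfOrientation w k x) (A B : Finset V) :
    cutWeight x (A ∩ B) - 2 * k + (cutWeight x (A ∪ B) - 2 * k) ≤
      cutWeight x A - 2 * k + (cutWeight x B - 2 * k) := by
  have := cutWeight_submodular (fun u v => (h.1 u v).1) A B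
  linarith

lemma HalfOrientation.tight_union (h : HalfOrientation w k x) {A B : Finset V} {b c : V}
    (hA : cutWeight x A - 2 * k = 0) (hB : cutWeight x B - 2 * k = 0) (hbA : b ∉ A) (hbB : b ∉ B)
    (hcA : c ∈ A) (hcB : c ∈ B) : cutWeight x (A ∪ B) - 2 * k = 0 := by
  have h1 := h.submodular A B
  have h2 := h.2 (A ∩ B) (proper_of_mem (u := c) (v := b) (by simp [*]) (by simp [*]))
  have h3 := h.2 (A ∪ B) (proper_of_mem (u := c) (v := b) (by simp [*]) (by simp [*]))
  omega

/-- A handshake argument in the graph of half edges. If there were no successor, `b` would have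
degree one, since `b` is trivially exchangeable with itself, and every other vertex with a half edge
would lie in a tight set avoiding `b`. A tight set has even weight, hence even degree sum, and
maximal tight sets avoiding `b` are disjoint. The total degree would be odd. -/
lemma HalfOrientation.exists_successor (h : HalfOrientation w k x) {a b : V} (hab : x a b = 1) :
    ∃ c d, x c d = 1 ∧ Exchangeable (fun Z => cutWeight x Z - 2 * k) c b ∧ (c, d) ≠ (b, a) := by
  by_contra! H
  set φ : V → V → ZMod 2 := fun u v => (x u v : ZMod 2) with hφ
  have hsymm : ∀ u v, φ u v = φ v u := by
    intro u v
    have h1 := (h.1 u v).2.2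
    have h2 : (x u v : ZMod 2) + x v u = 0 := by
      rw [← Int.cast_add, h1, Int.cast_mul]
      have : ((2 : ℤ) : ZMod 2) = 0 := by decide
      rw [this, zero_mul]
    exact CharTwo.add_eq_zero.1 h2
  have hdiag : ∀ u, φ u u = 0 := by
    intro u
    have h1 := (h.1 u u).2.2
    have h2 : x u u = 2 * w u u := by omega
    have : ((2 : ℤ) : ZMod 2) = 0 := by decide
    simp only [hφ, h2, Int.cast_mul, this, zero_mul]
  have hφ0 : ∀ u v, x u v ≠ 1 → φ u v = 0 := by
    intro u v huv
    have h1 := h.1 u v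
    obtain h2 | h2 : x u v = 0 ∨ x u v = 2 := by omega
    · simp [hφ, h2]
    · simp only [hφ, h2]; decide
  set ψ : Finset V → ZMod 2 := fun U => ∑ u ∈ U, ∑ v, φ u v with hψ
  have htight : ∀ Z, cutWeight x Z - 2 * k = 0 → ψ Z = 0 := by
    intro Z hZ
    have h1 : ((cutWeight x Z : ℤ) : ZMod 2) = 0 := by
      rw [show cutWeight x Z = 2 * k by omega, Int.cast_mul]
      have : ((2 : ℤ) : ZMod 2) = 0 := by decide
      rw [this, zero_mul]
    have h2 : ((cutWeight x Z : ℤ) : ZMod 2) = ∑ u ∈ Z, ∑ v ∈ Zᶜ, φ u v := by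
      simp only [cutWeight, Int.cast_sum, Int.cast_ite, Int.cast_zero, hφ, ite_and]
      rw [← sum_filter_add_sum_filter_not univ (· ∈ Z),
        sum_eq_zero (s := univ.filter (· ∉ Z)), add_zero]
      · refine sum_congr (by ext; simp) fun u hu => ?_
        have hu : u ∈ Z := by simpa using hu
        simp only [hu, if_true]
        rw [← sum_filter]
        exact sum_congr (by ext; simp) fun _ _ => rfl
      · intro u hu
        have hu : u ∉ Z := by simpa using hu
        simp [hu]
    have h3 : ψ Z = ∑ u ∈ Z, ∑ v ∈ Z, φ u v + ∑ u ∈ Z, ∑ v ∈ Zᶜ, φ u v := by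
      rw [← sum_add_distrib]
      exact sum_congr rfl fun u _ => (sum_add_sum_compl Z _).symm
    rw [h3, sum_sum_symm_eq_zero hsymm hdiag, ← h2, h1, add_zero]
  have hb : ∑ v, φ b v = 1 := by
    rw [sum_eq_single a]
    · simp [hφ, h.symm hab]
    · intro d _ hd
      refine hφ0 b d fun hbd => hd ?_
      have := H b d hbd (fun _ _ h => h)
      simpa using this
    · simp
  have hall : ψ univ = 0 := sum_sum_symm_eq_zero hsymm hdiag univ
  -- The third condition makes a maximal tight set avoiding `b` either contained in `U` or disjoint
  -- from it, so that `U` can grow until it covers all vertices of nonzero degree parity other than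
  -- `b`.
  let good : Finset V → Prop := fun U => b ∉ U ∧ ψ U = 0 ∧
    ∀ Z, cutWeight x Z - 2 * k = 0 → b ∉ Z → (∃ c ∈ Z, c ∈ U) → Z ⊆ U
  obtain ⟨U, hU, hmax⟩ := exists_max_image (univ.filter good) card
    ⟨∅, by simp [good, hψ]⟩
  simp only [mem_filter, mem_univ, true_and] at hU hmax
  obtain ⟨hbU, hψU, hUZ⟩ := hU
  have hcover : ∀ c, c ≠ b → c ∉ U → ∑ v, φ c v = 0 := by
    intro c hc hcU
    by_contra hne
    obtain ⟨d, -, hd⟩ := exists_ne_zero_of_sum_ne_zero hne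
    have hcd : x c d = 1 := by
      by_contra h'
      exact hd (hφ0 c d h')
    have hnex : ¬ Exchangeable (fun Z => cutWeight x Z - 2 * k) c b := fun h' => by
      have := H c d hcd h'
      simp [hc] at this
    simp only [Exchangeable, not_forall] at hnex
    obtain ⟨Z₀, hZ₀, hcZ₀, hbZ₀⟩ := hnex
    obtain ⟨Z, hZ, hZmax⟩ := exists_max_image
      (univ.filter fun Z : Finset V => cutWeight x Z - 2 * k = 0 ∧ c ∈ Z ∧ b ∉ Z) card
      ⟨Z₀, by simp only [mem_filter, mem_univ, true_and]; exact ⟨hZ₀, hcZ₀, hbZ₀⟩⟩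
    simp only [mem_filter, mem_univ, true_and] at hZ hZmax
    obtain ⟨hZt, hcZ, hbZ⟩ := hZ
    have hdisj : Disjoint U Z := by
      rw [disjoint_left]
      intro e heU heZ
      exact hcU (hUZ Z hZt hbZ ⟨e, heZ, heU⟩ hcZ)
    have hgood : good (U ∪ Z) := by
      refine ⟨by simp [hbU, hbZ], ?_, ?_⟩
      · simp only [hψ] at hψU ⊢
        rw [sum_union hdisj, hψU, zero_add]
        exact htight Z hZt
      · rintro Z' hZ' hbZ' ⟨e, heZ', he⟩
        rcases mem_union.1 he with he | he
        · exact (hUZ Z' hZ' hbZ' ⟨e, heZ', he⟩).trans subset_union_left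
        · have ht := h.tight_union hZt hZ' hbZ hbZ' he heZ'
          have hle := hZmax (Z ∪ Z') ⟨ht, by simp [hcZ], by simp [hbZ, hbZ']⟩
          have heq := eq_of_subset_of_card_le (subset_union_left (s₂ := Z')) hle
          have : Z' ⊆ Z := by rw [heq]; exact subset_union_right
          exact this.trans subset_union_right
    have hle := hmax _ hgood
    rw [card_union_of_disjoint hdisj] at hle
    have := card_pos.2 ⟨c, hcZ⟩
    omega
  have h1 : ψ univ = ψ U + 1 := by
    simp only [hψ]
    rw [← sum_add_sum_compl U, add_right_inj, sum_eq_single b]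
    · exact hb
    · intro c hc hcb
      exact hcover c hcb (by simpa using hc)
    · intro h'
      simp [hbU] at h'
  rw [hall, hψU] at h1
  simp at h1

end Rounding

lemma cutWeight_single (a b : V) (Z : Finset V) :
    cutWeight (fun u v => (if (a, b) = (v, u) then 1 else 0) - if (a, b) = (u, v) then 1 else 0) Z =
      ind Z b - ind Z a := by
  have h := cutWeight_sub_compl (fun u v => if (a, b) = (v, u) then 1 else 0) Z
  rw [cutWeight_compl] at h
  have h2 : cutWeight (fun u v => (if (a, b) = (v, u) then (1 : ℤ) else 0) -
      if (a, b) = (u, v) then 1 else 0) Z = cutWeight (fun u v => if (a, b) = (v, u) then 1 else 0) Z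
      - cutWeight (fun u v => if (a, b) = (u, v) then 1 else 0) Z := by
    have := cutWeight_add (fun u v => (if (a, b) = (v, u) then (1 : ℤ) else 0) -
      if (a, b) = (u, v) then 1 else 0) (fun u v => if (a, b) = (u, v) then 1 else 0) Z
    simp only [sub_add_cancel] at this
    omega
  rw [h2, h]
  simp only [sum_sub_distrib, Prod.mk.injEq, ite_and, sum_ite_eq, mem_univ, if_true, ind]
  simp

lemma cutWeight_sum {ι : Type*} (s : Finset ι) (x : ι → V → V → ℤ) (Z : Finset V) :
    cutWeight (fun u v => ∑ i ∈ s, x i u v) Z = ∑ i ∈ s, cutWeight (x i) Z := by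
  induction s using Finset.induction_on with
  | empty => simp [cutWeight]
  | insert i s hi ih => simp only [sum_insert hi, cutWeight_add, ih]

/-- All half edges on a shortest cycle of the successor relation are rounded at once. Minimality
gives the absence of shortcuts required by `exchange_simultaneously`, and keeps the half edges of
the cycle distinct. -/
lemma HalfOrientation.exists_fewer_halves {w x : V → V → ℤ} {k : ℕ} (h : HalfOrientation w k x)
    {a b : V} (hab : x a b = 1) : ∃ x', HalfOrientation w k x' ∧ (∀ u v, x' u v = 1 → x u v = 1) ∧
      ∃ a b, x a b = 1 ∧ x' a b ≠ 1 := by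
  set s : Finset V → ℤ := fun Z => cutWeight x Z - 2 * k with hs
  let T : V × V → V × V → Prop := fun p q => x p.1 p.2 = 1 ∧ x q.1 q.2 = 1 ∧
    Exchangeable s q.1 p.2 ∧ q ≠ p.swap
  obtain ⟨r, hr, t, ht0, htT, htmin⟩ := exists_shortest_cycle T (F := fun p => x p.1 p.2 = 1)
    (s₀ := (a, b)) (by
      rintro ⟨c, d⟩ hcd
      obtain ⟨c', d', h1, h2, h3⟩ := h.exists_successor hcd
      exact ⟨(c', d'), h1, hcd, h1, h2, h3⟩) hab
  have hfrac : ∀ i < r, x (t i).1 (t i).2 = 1 := fun i hi => (htT i hi).1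
  -- A half edge used in both directions would let the exchanges next to its two occurrences compose
  -- to a chord around the part in between.
  have hopp : ∀ d i, i + d < r → t (i + d) ≠ (t i).swap := by
    intro d
    induction d using Nat.strong_induction_on with
    | _ d ih =>
      intro i hi he
      match d, ih, hi, he with
      | 0, _, hi, he =>
        have h1 : (t i).1 = (t i).2 := by
          have := congrArg Prod.fst he
          simpa using this
        have h2 := hfrac i hi
        rw [h1] at h2
        have := h.1 (t i).2 (t i).2
        omega
      | 1, _, hi, he => exact (htT i (by omega)).2.2.2 he
      | d + 2, ih, hi, he =>
        refine htmin (i + 1) (i + 1 + d) (by omega) (by omega) (by omega)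
          ⟨hfrac _ (by omega), hfrac _ (by omega), ?_, ?_⟩
        · have h1 := (htT i (by omega)).2.2.1
          have h2 := (htT (i + 1 + d) (by omega)).2.2.1
          rw [show i + 1 + d + 1 = i + (d + 2) by omega, he] at h2
          exact h1.trans h2
        · intro h'
          refine ih d (by omega) (i + 1) (by omega) ?_
          rw [h', Prod.swap_swap]
  have hinj : ∀ i j, i < j → j < r → t i ≠ t j := by
    intro i j hij hj he
    have := htT (j - 1) (by omega)
    rw [show j - 1 + 1 = j by omega, ← he] at this
    exact htmin i (j - 1) (by omega) (by omega) (by omega) this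
  have hinj' : ∀ i j, i < r → j < r → t i = t j → i = j := by
    intro i j hi hj he
    rcases lt_trichotomy i j with h1 | h1 | h1
    · exact absurd he (hinj i j h1 hj)
    · exact h1
    · exact absurd he.symm (hinj j i h1 hi)
  have hopp' : ∀ i j, i < r → j < r → t i ≠ (t j).swap := by
    intro i j hi hj he
    rcases le_total i j with h1 | h1
    · obtain ⟨d, rfl⟩ := Nat.exists_eq_add_of_le h1
      exact hopp d i hj (by rw [he, Prod.swap_swap])
    · obtain ⟨d, rfl⟩ := Nat.exists_eq_add_of_le h1
      exact hopp d j hi he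
  set c : V → V → ℤ := fun u v => ∑ i ∈ range r, if t i = (u, v) then 1 else 0 with hc
  have hc1 : ∀ i < r, c (t i).1 (t i).2 = 1 := by
    intro i hi
    simp only [hc]
    rw [sum_eq_single i]
    · simp
    · intro j hj hji
      rw [if_neg]
      intro h'
      exact hji (hinj' j i (mem_range.1 hj) hi h')
    · intro h'
      simp [hi] at h'
  have hc0 : ∀ u v, (∀ i < r, t i ≠ (u, v)) → c u v = 0 := by
    intro u v h'
    exact sum_eq_zero fun i hi => if_neg (h' i (mem_range.1 hi))
  have hcases : ∀ u v, (c u v = 0 ∧ c v u = 0) ∨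
      (x u v = 1 ∧ ((c u v = 1 ∧ c v u = 0) ∨ (c u v = 0 ∧ c v u = 1))) := by
    intro u v
    by_cases h1 : ∃ i < r, t i = (u, v)
    · obtain ⟨i, hi, he⟩ := h1
      have h2 := hc1 i hi
      have h3 := hfrac i hi
      have h4 : c v u = 0 := hc0 v u fun j hj he' => hopp' j i hj hi (by rw [he, he']; rfl)
      rw [he] at h2 h3
      exact Or.inr ⟨h3, Or.inl ⟨h2, h4⟩⟩
    · by_cases h2 : ∃ i < r, t i = (v, u)
      · obtain ⟨i, hi, he⟩ := h2
        have h2 := hc1 i hi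
        have h3 := hfrac i hi
        have h4 : c u v = 0 := hc0 u v fun j hj he' => hopp' j i hj hi (by rw [he, he']; rfl)
        rw [he] at h2 h3
        exact Or.inr ⟨h.symm h3, Or.inr ⟨h4, h2⟩⟩
      · push Not at h1 h2
        exact Or.inl ⟨hc0 _ _ h1, hc0 _ _ h2⟩
  refine ⟨fun u v => x u v + (c v u - c u v), ⟨fun u v => ?_, fun Z hZ => ?_⟩, fun u v => ?_, ?_⟩
  · have h1 := h.1 u v
    refine ⟨?_, ?_, by linarith⟩
    all_goals
      rcases hcases u v with h2 | ⟨h2, h3 | h3⟩ <;> dsimp only <;> omega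
  · have hx : cutWeight (fun u v => x u v + (c v u - c u v)) Z =
        cutWeight x Z + ∑ i ∈ range r, (ind Z (t i).2 - ind Z (t i).1) := by
      rw [cutWeight_add]
      congr 1
      simp only [hc, ← sum_sub_distrib]
      rw [cutWeight_sum]
      refine sum_congr rfl fun i _ => ?_
      exact cutWeight_single (t i).1 (t i).2 Z
    -- Rounding `t i` moves a unit from its tail to its head. Around the cycle the tails can be
    -- shifted by one place, which turns the total into a sum of exchanges between consecutive half
    -- edges.
    have hshift : ∑ i ∈ range r, (ind Z (t i).2 - ind Z (t i).1) =
        ∑ i ∈ range r, (ind Z (t i).2 - ind Z (t (i + 1)).1) := by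
      simp only [sum_sub_distrib]
      congr 1
      have h1 := sum_range_succ (fun i => ind Z (t i).1) r
      have h2 := sum_range_succ' (fun i => ind Z (t i).1) r
      rw [ht0] at h1
      linarith
    have key := exchange_simultaneously (fun i => (t (i + 1)).1) (fun i => (t i).2) r s
      (fun A B _ _ => h.submodular A B) (fun Z hZ => by have := h.2 Z hZ; simp only [hs]; linarith)
      (fun i hi => (htT i hi).2.2.1) ?_ Z hZ
    · rw [hx, hshift]
      simp only [hs] at key
      linarith
    · intro j hj i hij hE
      refine htmin (i + 1) j (by omega) hj (by omega) ⟨hfrac _ hj, hfrac _ (by omega), hE, ?_⟩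
      exact hopp' _ _ (by omega) hj
  · intro h1
    rcases hcases u v with ⟨h2, h3⟩ | ⟨h2, -⟩
    · dsimp only at h1
      omega
    · exact h2
  · refine ⟨(t 0).1, (t 0).2, hfrac 0 (by omega), ?_⟩
    have h1 := hfrac 0 (by omega)
    have h2 := hc1 0 (by omega)
    rcases hcases (t 0).1 (t 0).2 with h3 | ⟨-, h3 | h3⟩ <;> dsimp only <;> omega

lemma HalfOrientation.exists_integral {w : V → V → ℤ} {k : ℕ} : ∀ (m : ℕ) (x : V → V → ℤ),
    HalfOrientation w k x → (univ.filter fun p : V × V => x p.1 p.2 = 1).card = m →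
    ∃ x', HalfOrientation w k x' ∧ ∀ u v, x' u v ≠ 1 := by
  intro m
  induction m using Nat.strong_induction_on with
  | _ m ih =>
    intro x hx hm
    by_cases h : ∃ a b, x a b = 1
    · obtain ⟨a, b, hab⟩ := h
      obtain ⟨x', hx', hsub, c, d, hcd, hcd'⟩ := hx.exists_fewer_halves hab
      refine ih _ ?_ x' hx' rfl
      rw [← hm]
      refine card_lt_card ⟨fun p hp => ?_, fun h' => ?_⟩
      · simp only [mem_filter, mem_univ, true_and] at hp ⊢
        exact hsub _ _ hp
      · have := h' (mem_filter.2 ⟨mem_univ (c, d), hcd⟩)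
        exact hcd' (mem_filter.1 this).2
    · push Not at h
      exact ⟨x, hx, h⟩

/-! ### Strong reorientations of digraphs with large cuts. -/

/-- The indicator of the arcs of a digraph. -/
noncomputable def arcWeight {V : Type*} (D : Digraph V) (u v : V) : ℤ := if D.Adj u v then 1 else 0

/-- The number of arcs of `D` leaving `Z`. -/
noncomputable def outCut (D : Digraph V) (Z : Finset V) : ℤ := cutWeight (arcWeight D) Z

/-- The number of arcs of `D` between `u` and `v`. -/
noncomputable def mult {V : Type*} (D : Digraph V) (u v : V) : ℤ := arcWeight D u v + arcWeight D v u

/-- The number of arcs of `D` with exactly one end in `Z`. -/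
noncomputable def totalCut (D : Digraph V) (Z : Finset V) : ℤ := cutWeight (mult D) Z

/-- Every proper set is left by at least `k` arcs. -/
def Strong (k : ℕ) (D : Digraph V) : Prop := ∀ Z, Proper Z → (k : ℤ) ≤ outCut D Z

/-- Every cut of the underlying multigraph has at least `2 * k` edges. -/
def LargeCuts (k : ℕ) (D : Digraph V) : Prop := ∀ Z, Proper Z → 2 * (k : ℤ) ≤ totalCut D Z

/-- Two digraphs have the same underlying multigraph. -/
def SameMult {V : Type*} (D D' : Digraph V) : Prop := ∀ u v, mult D u v = mult D' u v

/-- A digraph whose underlying multigraph is `2 * k`-edge-connected has a `k`-arc-strong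
reorientation that keeps all digons. -/
theorem LargeCuts.exists_strong {k : ℕ} {D : Digraph V} (h : LargeCuts k D) :
    ∃ D', SameMult D' D ∧ Strong k D' := by
  have h01 : ∀ u v, arcWeight D u v = 0 ∨ arcWeight D u v = 1 := by
    intro u v
    simp only [arcWeight]
    split_ifs <;> simp
  -- Every edge is split evenly between its two directions. A digon has weight `2` each way, and the
  -- upper bound `2` forces it to remain a digon throughout the rounding.
  have h0 : HalfOrientation (arcWeight D) k (mult D) := by
    refine ⟨fun u v => ?_, h⟩
    have h1 := h01 u v
    have h2 := h01 v u
    simp only [mult]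
    omega
  obtain ⟨x, hx, hx1⟩ := HalfOrientation.exists_integral _ _ h0 rfl
  have hw : ∀ u v, 2 * arcWeight ⟨fun u v => x u v = 2⟩ u v = x u v := by
    intro u v
    have h1 := hx.1 u v
    have h2 := hx1 u v
    simp only [arcWeight]
    split_ifs with h3 <;> omega
  refine ⟨⟨fun u v => x u v = 2⟩, fun u v => ?_, fun Z hZ => ?_⟩
  · have h1 := hw u v
    have h2 := hw v u
    have h3 := (hx.1 u v).2.2
    simp only [mult]
    linarith
  · have h1 := hx.2 Z hZ
    have h2 := cutWeight_const_mul 2 (arcWeight ⟨fun u v => x u v = 2⟩) Z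
    simp only [hw] at h2
    simp only [outCut]
    linarith

end Cuts

/-! ### Reversals as vectors over `ZMod 2`. -/

section Flip

variable {V : Type*}

/-- The digraph obtained by reversing the arcs on the pairs where `f` is `1`. -/
def flip (D : Digraph V) (f : Sym2 V → ZMod 2) : Digraph V where
  Adj u v := (f s(u, v) = 1 ∧ D.Adj v u) ∨ (f s(u, v) = 0 ∧ D.Adj u v)

/-- The indicator of the pair `a`, `b`. -/
noncomputable def edge (a b : V) : Sym2 V → ZMod 2 := Pi.single s(a, b) 1

/-- The indicator of the pairs inside `X`. -/
noncomputable def clique (X : Finset V) : Sym2 V → ZMod 2 := fun e => if e ∈ X.sym2 then 1 else 0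

/-- The sums of indicators of cliques of size `p`. -/
def cliqueSpan (V : Type*) (p : ℕ) : AddSubgroup (Sym2 V → ZMod 2) :=
  AddSubgroup.closure {f | ∃ X : Finset V, X.card = p ∧ f = clique X}

/-- The sums of indicators of pairs in the relation `K`. -/
def edgeSpan (K : V → V → Prop) : AddSubgroup (Sym2 V → ZMod 2) :=
  AddSubgroup.closure {f | ∃ a b, a ≠ b ∧ K a b ∧ f = edge a b}

/-- A pair which carries no arc or a digon. -/
def SymPair (D : Digraph V) (a b : V) : Prop := D.Adj a b ↔ D.Adj b a

lemma zmod_two (z : ZMod 2) : z = 0 ∨ z = 1 := by revert z; decide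

lemma add_self_pairs (f : Sym2 V → ZMod 2) : f + f = 0 := by
  funext e
  exact CharTwo.add_self_eq_zero _

lemma neg_pairs (f : Sym2 V → ZMod 2) : -f = f := by
  funext e
  exact CharTwo.neg_eq _

lemma edge_comm (a b : V) : edge a b = edge b a := by
  simp only [edge, Sym2.eq_swap]

lemma edge_apply {a b : V} (hab : a ≠ b) (x y : V) :
    edge a b s(x, y) = (if x = a then 1 else 0) * (if y = b then 1 else 0) +
      (if x = b then 1 else 0) * (if y = a then 1 else 0) := by
  simp only [edge, Pi.single_apply, Sym2.eq_iff]
  by_cases h1 : x = a <;> by_cases h2 : y = b <;> by_cases h3 : x = b <;> by_cases h4 : y = a <;>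
    simp_all

lemma clique_apply (X : Finset V) (x y : V) :
    clique X s(x, y) = (if x ∈ X then 1 else 0) * (if y ∈ X then 1 else 0) := by
  simp only [clique, mk_mem_sym2_iff]
  split_ifs <;> simp_all

lemma flip_zero (D : Digraph V) : flip D 0 = D := by
  ext u v
  simp [flip]

lemma flip_flip (D : Digraph V) (f g : Sym2 V → ZMod 2) : flip (flip D f) g = flip D (f + g) := by
  ext u v
  simp only [flip, Pi.add_apply, Sym2.eq_swap (a := v) (b := u)]
  rcases zmod_two (f s(u, v)) with h | h <;> rcases zmod_two (g s(u, v)) with h' | h' <;>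
    simp [h, h', CharTwo.add_self_eq_zero]

lemma invert_eq_flip (D : Digraph V) (X : Finset V) : invert D X = flip D (clique X) := by
  ext u v
  simp only [invert, flip, clique_apply]
  by_cases h1 : u ∈ X <;> by_cases h2 : v ∈ X <;> simp [h1, h2]

lemma invertAll_eq_flip (L : List (Finset V)) : ∀ D : Digraph V,
    invertAll D L = flip D (L.map clique).sum := by
  induction L with
  | nil => intro D; simp [invertAll, flip_zero]
  | cons X L ih =>
    intro D
    have : invertAll D (X :: L) = invertAll (invert D X) L := rfl
    rw [this, ih, invert_eq_flip, flip_flip]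
    simp

lemma exists_list_of_mem_cliqueSpan {p : ℕ} {f : Sym2 V → ZMod 2} (hf : f ∈ cliqueSpan V p) :
    ∃ L : List (Finset V), (∀ X ∈ L, X.card = p) ∧ (L.map clique).sum = f := by
  induction hf using AddSubgroup.closure_induction with
  | mem f hf =>
    obtain ⟨X, hX, rfl⟩ := hf
    exact ⟨[X], by simpa using hX, by simp⟩
  | zero => exact ⟨[], by simp, by simp⟩
  | add f g _ _ hf hg =>
    obtain ⟨L, hL, rfl⟩ := hf
    obtain ⟨M, hM, rfl⟩ := hg
    refine ⟨L ++ M, fun X hX => ?_, by simp⟩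
    rcases List.mem_append.1 hX with h | h
    · exact hL X h
    · exact hM X h
  | neg f _ hf => rwa [neg_pairs]

lemma edge_mem_edgeSpan {K : V → V → Prop} {a b : V} (hab : a ≠ b) (h : K a b) :
    edge a b ∈ edgeSpan K :=
  AddSubgroup.subset_closure ⟨a, b, hab, h, rfl⟩

lemma flip_eq_self_of_mem {D : Digraph V} {f : Sym2 V → ZMod 2} (hf : f ∈ edgeSpan (SymPair D)) :
    flip D f = D := by
  induction hf using AddSubgroup.closure_induction with
  | mem f hf =>
    obtain ⟨a, b, hab, h, rfl⟩ := hf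
    ext u v
    simp only [flip, edge, Pi.single_apply, Sym2.eq_iff]
    simp only [SymPair] at h
    by_cases h1 : u = a ∧ v = b ∨ u = b ∧ v = a
    · rcases h1 with ⟨rfl, rfl⟩ | ⟨rfl, rfl⟩ <;> simp [h]
    · simp [h1]
  | zero => exact flip_zero D
  | add f g _ _ hf hg => rw [← flip_flip, hf, hg]
  | neg f _ hf => rwa [neg_pairs]

lemma flip_mono {D₀ D : Digraph V} (h : ∀ u v, D₀.Adj u v → D.Adj u v) (f : Sym2 V → ZMod 2)
    (u v : V) : (flip D₀ f).Adj u v → (flip D f).Adj u v := by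
  rintro (⟨h1, h2⟩ | ⟨h1, h2⟩)
  · exact Or.inl ⟨h1, h _ _ h2⟩
  · exact Or.inr ⟨h1, h _ _ h2⟩

lemma mult_flip (D : Digraph V) (f : Sym2 V → ZMod 2) : SameMult (flip D f) D := by
  intro u v
  simp only [mult, arcWeight, flip, Sym2.eq_swap (a := v) (b := u)]
  rcases zmod_two (f s(u, v)) with h | h <;> simp [h, add_comm]

lemma arcWeight_flip_edge {D : Digraph V} {a b : V} (hab : D.Adj a b) (hba : ¬ D.Adj b a)
    (u v : V) : arcWeight (flip D (edge a b)) u v = arcWeight D u v +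
      ((if (a, b) = (v, u) then 1 else 0) - if (a, b) = (u, v) then 1 else 0) := by
  have hne : a ≠ b := by rintro rfl; exact hba hab
  simp only [arcWeight, flip, edge, Pi.single_apply, Sym2.eq_iff, Prod.mk.injEq]
  by_cases h1 : a = u ∧ b = v
  · obtain ⟨rfl, rfl⟩ := h1
    simp [hab, hba, hne]
  · by_cases h2 : a = v ∧ b = u
    · obtain ⟨rfl, rfl⟩ := h2
      simp [hab, hba, hne, hne.symm]
    · have h1' : ¬ (u = a ∧ v = b) := fun h => h1 ⟨h.1.symm, h.2.symm⟩
      have h2' : ¬ (u = b ∧ v = a) := fun h => h2 ⟨h.2.symm, h.1.symm⟩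
      simp [h1, h2, h1', h2']

end Flip

/-! ### Effect of flips on cuts, and the span of the cliques of size `p`. -/

section Finite

variable {V : Type*} [Fintype V]

lemma outCut_flip_edge {D : Digraph V} {a b : V} (hab : D.Adj a b) (hba : ¬ D.Adj b a)
    (Z : Finset V) : outCut (flip D (edge a b)) Z = outCut D Z + (ind Z b - ind Z a) := by
  rw [← cutWeight_single a b Z]
  simp only [outCut]
  rw [← cutWeight_add]
  exact cutWeight_congr fun u _ v _ => arcWeight_flip_edge hab hba u v

lemma outCut_mono {D₀ D : Digraph V} (h : ∀ u v, D₀.Adj u v → D.Adj u v) (Z : Finset V) :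
    outCut D₀ Z ≤ outCut D Z := by
  refine cutWeight_mono fun u _ v _ => ?_
  simp only [arcWeight]
  have := h u v
  split_ifs <;> simp_all

lemma Strong.mono {k : ℕ} {D₀ D : Digraph V} (h : ∀ u v, D₀.Adj u v → D.Adj u v)
    (hs : Strong k D₀) : Strong k D := fun Z hZ => (hs Z hZ).trans (outCut_mono h Z)

lemma totalCut_eq (D : Digraph V) (Z : Finset V) : totalCut D Z = outCut D Z + outCut D Zᶜ := by
  simp only [totalCut, outCut, cutWeight_compl]
  rw [← cutWeight_add]
  rfl

lemma totalCut_compl (D : Digraph V) (Z : Finset V) : totalCut D Zᶜ = totalCut D Z := by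
  rw [totalCut_eq, totalCut_eq, compl_compl, add_comm]

lemma SameMult.totalCut_eq {D D' : Digraph V} (h : SameMult D D') (Z : Finset V) :
    totalCut D Z = totalCut D' Z := cutWeight_congr fun u _ v _ => h u v

lemma adj_iff_arcWeight {V : Type*} (D : Digraph V) (u v : V) : D.Adj u v ↔ arcWeight D u v = 1 := by
  simp [arcWeight]

lemma arcWeight_eq {V : Type*} (D : Digraph V) (u v : V) :
    arcWeight D u v = 0 ∨ arcWeight D u v = 1 := by
  simp only [arcWeight]
  split_ifs <;> simp

lemma arcWeight_nonneg {V : Type*} (D : Digraph V) (u v : V) : 0 ≤ arcWeight D u v := by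
  rcases arcWeight_eq D u v with h | h <;> omega

lemma mult_nonneg {V : Type*} (D : Digraph V) (u v : V) : 0 ≤ mult D u v :=
  add_nonneg (arcWeight_nonneg D u v) (arcWeight_nonneg D v u)

lemma mult_comm {V : Type*} (D : Digraph V) (u v : V) : mult D u v = mult D v u := add_comm _ _

lemma symPair_iff {V : Type*} (D : Digraph V) (u v : V) : SymPair D u v ↔ mult D u v ≠ 1 := by
  simp only [SymPair, adj_iff_arcWeight, mult]
  rcases arcWeight_eq D u v with h | h <;> rcases arcWeight_eq D v u with h' | h' <;> simp [h, h']

/-- Digraphs with the same underlying multigraph differ by flips of single arcs. -/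
lemma SameMult.exists_flip {D' : Digraph V} : ∀ (m : ℕ) (D : Digraph V), SameMult D' D →
    (univ.filter fun p : V × V => D.Adj p.1 p.2 ∧ ¬ D'.Adj p.1 p.2).card = m →
    ∃ f ∈ edgeSpan (fun _ _ : V => True), flip D f = D' := by
  intro m
  induction m using Nat.strong_induction_on with
  | _ m ih =>
    intro D hD hm
    by_cases h : ∃ a b, D.Adj a b ∧ ¬ D'.Adj a b
    · obtain ⟨a, b, hab, hab'⟩ := h
      have hba : ¬ D.Adj b a ∧ D'.Adj b a := by
        have := hD a b
        simp only [mult, adj_iff_arcWeight] at *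
        rcases arcWeight_eq D' a b with h | h <;> rcases arcWeight_eq D' b a with h' | h' <;>
          rcases arcWeight_eq D b a with h'' | h'' <;> omega
      have hne : a ≠ b := by rintro rfl; exact hba.1 hab
      have hsame : SameMult D' (flip D (edge a b)) := fun u v =>
        (hD u v).trans (mult_flip D (edge a b) u v).symm
      suffices hlt : (univ.filter fun p : V × V =>
          (flip D (edge a b)).Adj p.1 p.2 ∧ ¬ D'.Adj p.1 p.2).card < m by
        obtain ⟨f, hf, hfD⟩ := ih _ hlt (flip D (edge a b)) hsame rfl
        exact ⟨edge a b + f, add_mem (edge_mem_edgeSpan hne trivial) hf, by rw [← flip_flip, hfD]⟩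
      rw [← hm]
      refine card_lt_card ⟨fun p hp => ?_, fun h' => ?_⟩
      · simp only [mem_filter, mem_univ, true_and] at hp ⊢
        refine ⟨?_, hp.2⟩
        have h1 := hp.1
        rw [adj_iff_arcWeight, arcWeight_flip_edge hab hba.1] at h1
        rw [adj_iff_arcWeight]
        by_cases h2 : (a, b) = (p.2, p.1)
        · simp only [Prod.mk.injEq] at h2
          rw [← h2.1, ← h2.2] at hp
          exact absurd hba.2 hp.2
        · rw [if_neg h2] at h1
          rcases arcWeight_eq D p.1 p.2 with h3 | h3
          · split_ifs at h1 <;> omega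
          · exact h3
      · have := h' (mem_filter.2 ⟨mem_univ (a, b), hab, hab'⟩)
        have := (mem_filter.1 this).2.1
        rw [adj_iff_arcWeight, arcWeight_flip_edge hab hba.1] at this
        simp [hne, (adj_iff_arcWeight D a b).1 hab] at this
    · push Not at h
      refine ⟨0, zero_mem _, ?_⟩
      rw [flip_zero]
      ext u v
      refine ⟨h u v, fun h1 => ?_⟩
      have h2 := hD u v
      have h3 := h u v
      have h4 := h v u
      simp only [mult, adj_iff_arcWeight] at *
      grind [arcWeight_eq]

/-- The inversions of size `p` generate all cycles of length four. -/
lemma four_cycle_mem {p : ℕ} (hp : 2 ≤ p) (hn : p + 2 ≤ Fintype.card V) {u v a b : V}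
    (hua : u ≠ a) (hub : u ≠ b) (hva : v ≠ a) (hvb : v ≠ b) :
    edge u a + edge v a + (edge u b + edge v b) ∈ cliqueSpan V p := by
  have hcard : p - 2 ≤ ({u, v, a, b} : Finset V)ᶜ.card := by
    rw [card_compl]
    have : ({u, v, a, b} : Finset V).card ≤ 4 := card_le_four
    omega
  -- One common set `A` of `p - 2` further vertices completes each of the four pairs to a set of
  -- size `p`; in the sum of the four cliques everything except the 4-cycle occurs an even number of
  -- times.
  obtain ⟨A, hA, hAc⟩ := exists_subset_card_eq hcard
  have hmem : ∀ x ∈ ({u, v, a, b} : Finset V), x ∉ A := fun x hx hxA => by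
    have := hA hxA
    rw [mem_compl] at this
    exact this hx
  have huA := hmem u (by simp)
  have hvA := hmem v (by simp)
  have haA := hmem a (by simp)
  have hbA := hmem b (by simp)
  have hcl : ∀ x y, x ≠ y → x ∉ A → y ∉ A → clique (insert x (insert y A)) ∈ cliqueSpan V p := by
    intro x y hxy hx hy
    refine AddSubgroup.subset_closure ⟨_, ?_, rfl⟩
    rw [card_insert_of_notMem (by simp [hxy, hx]), card_insert_of_notMem hy, hAc]
    omega
  have hval : ∀ x y, x ≠ y → x ∉ A → y ∉ A → ∀ z, (if z ∈ insert x (insert y A) then (1 : ZMod 2)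
      else 0) = (if z ∈ A then 1 else 0) + (if z = x then 1 else 0) + if z = y then 1 else 0 := by
    intro x y hxy hx hy z
    by_cases h1 : z = x
    · subst h1; simp [hx, hxy]
    · by_cases h2 : z = y
      · subst h2; simp [hy, h1]
      · simp [h1, h2]
  have hsum := add_mem (add_mem (hcl u a hua huA haA) (hcl v a hva hvA haA))
    (add_mem (hcl u b hub huA hbA) (hcl v b hvb hvA hbA))
  convert hsum using 1
  funext e
  induction e using Sym2.ind with
  | _ x y =>
    simp only [Pi.add_apply, clique_apply, edge_apply hua, edge_apply hva, edge_apply hub,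
      edge_apply hvb, hval u a hua huA haA, hval v a hva hvA haA, hval u b hub huA hbA,
      hval v b hvb hvA hbA]
    have h2 : (2 : ZMod 2) = 0 := by decide
    generalize (if x ∈ A then (1 : ZMod 2) else 0) = h
    generalize (if y ∈ A then (1 : ZMod 2) else 0) = h'
    generalize (if x = u then (1 : ZMod 2) else 0) = u1
    generalize (if y = u then (1 : ZMod 2) else 0) = u2
    generalize (if x = v then (1 : ZMod 2) else 0) = v1
    generalize (if y = v then (1 : ZMod 2) else 0) = v2
    generalize (if x = a then (1 : ZMod 2) else 0) = a1
    generalize (if y = a then (1 : ZMod 2) else 0) = a2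
    generalize (if x = b then (1 : ZMod 2) else 0) = b1
    generalize (if y = b then (1 : ZMod 2) else 0) = b2
    linear_combination (-(2 * h * h' + h * (u2 + v2 + a2 + b2) + h' * (u1 + v1 + a1 + b1) +
      u1 * u2 + v1 * v2 + a1 * a2 + b1 * b2)) * h2

/-- Modulo the inversions of size `p`, all pairs are described by a potential. -/
lemma exists_potential {p : ℕ} (hp : 2 ≤ p) (hn : p + 2 ≤ Fintype.card V) :
    ∃ (T : Sym2 V → ZMod 2) (q : V → Sym2 V → ZMod 2),
      ∀ a b, a ≠ b → edge a b + T + (q a + q b) ∈ cliqueSpan V p := by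
  obtain ⟨o, o₁, o₂, h01, h02, h12⟩ := Fintype.two_lt_card_iff.1 (by omega : 2 < Fintype.card V)
  set S := cliqueSpan V p
  let t : V → V → Sym2 V → ZMod 2 := fun a b => edge o a + edge o b + edge a b
  have htc : ∀ a b, t a b = t b a := by
    intro a b
    simp only [t, edge_comm a b, add_comm (edge o a)]
  -- Two triangles sharing the edge `oa` differ by a 4-cycle, so all triangles at `o` have the same
  -- class, which serves as `T`.
  have step : ∀ a b c, b ≠ o → c ≠ o → a ≠ b → a ≠ c → t a b + t a c ∈ S := by
    intro a b c hb hc hab hac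
    have h := four_cycle_mem hp hn hb.symm hc.symm hab hac
    convert h using 1
    have := add_self_pairs (edge o a)
    simp only [t]
    linear_combination this
  have trans : ∀ {f g h : Sym2 V → ZMod 2}, f + g ∈ S → g + h ∈ S → f + h ∈ S := by
    intro f g h h1 h2
    have := add_mem h1 h2
    convert this using 1
    linear_combination - add_self_pairs g
  have hT : ∀ a b, a ≠ o → b ≠ o → a ≠ b → t a b + t o₁ o₂ ∈ S := by
    intro a b ha hb hab
    by_cases h1 : a = o₁
    · subst h1; exact step _ _ _ hb h02.symm hab h12
    by_cases h2 : b = o₁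
    · subst h2; rw [htc]; exact step _ _ _ ha h02.symm hab.symm h12
    refine trans (step a b o₁ hb h01.symm hab h1) ?_
    rw [htc]
    exact step _ _ _ ha h02.symm (Ne.symm h1) h12
  have hT' : ∀ f : Sym2 V → ZMod 2, f + f ∈ S := fun f => by
    rw [add_self_pairs]; exact zero_mem _
  refine ⟨t o₁ o₂, fun a => if a = o then 0 else edge o a + t o₁ o₂, fun a b hab => ?_⟩
  by_cases ha : a = o
  · subst ha
    simp only [if_true, if_neg hab.symm, zero_add]
    exact hT' _
  · by_cases hb : b = o
    · subst hb
      simp only [if_true, if_neg ha, add_zero]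
      rw [edge_comm]
      exact hT' _
    · simp only [if_neg ha, if_neg hb]
      convert hT a b ha hb hab using 1
      simp only [t]
      linear_combination add_self_pairs (edge o o₁ + edge o o₂ + edge o₁ o₂)

end Finite

/-! ### Correcting the class of a reorientation. -/

section Solving

variable {V : Type*} [Fintype V]

/-- The pairs ending at `z` and the pairs starting at `a` share only `(a, z)` within the cut. -/
lemma sum_add_sum_le_cutWeight {x : V → V → ℤ} (hx : ∀ u v, 0 ≤ x u v) {Z : Finset V} {a z : V}
    (ha : a ∈ Z) (hz : z ∉ Z) :
    ∑ u ∈ Z, x u z + ∑ v ∈ Zᶜ, x a v ≤ cutWeight x Z + x a z := by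
  have h1 : ∑ u ∈ Z, x u z = ∑ u, ∑ v, if u ∈ Z ∧ v = z then x u v else 0 := by
    simp [ite_and]
  have h2 : ∑ v ∈ Zᶜ, x a v = ∑ u, ∑ v, if u = a ∧ v ∉ Z then x u v else 0 := by
    rw [sum_comm]
    simp only [ite_and, sum_ite_eq', mem_univ, if_true]
    rw [← sum_filter]
    exact sum_congr (by ext; simp) fun _ _ => rfl
  have h3 : x a z = ∑ u, ∑ v, if u = a ∧ v = z then x u v else 0 := by
    simp [ite_and]
  rw [h1, h2, h3, cutWeight]
  simp only [← sum_add_distrib]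
  refine sum_le_sum fun u _ => sum_le_sum fun v _ => ?_
  have := hx u v
  clear h1 h2 h3
  by_cases h1 : u = a <;> by_cases h2 : v = z <;> by_cases h3 : u ∈ Z <;> by_cases h4 : v ∈ Z <;>
    simp_all

lemma flip_edge_adj {V : Type*} {D : Digraph V} {a b u v : V} (h : ¬ (u = a ∧ v = b))
    (h' : ¬ (u = b ∧ v = a)) : (flip D (edge a b)).Adj u v ↔ D.Adj u v := by
  have h1 : ¬ s(u, v) = s(a, b) := by
    rw [Sym2.eq_iff]
    exact not_or.2 ⟨h, h'⟩
  simp only [flip, edge, Pi.single_apply, if_neg h1]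
  simp

lemma strong_flip_triangle {k : ℕ} {D : Digraph V} (hD : Strong k D) {a b c : V} (hab : D.Adj a b)
    (hba : ¬ D.Adj b a) (hbc : D.Adj b c) (hcb : ¬ D.Adj c b) (hca : D.Adj c a) (hac : ¬ D.Adj a c) :
    Strong k (flip D (edge a b + edge b c + edge c a)) := by
  have h1 : a ≠ b := by rintro rfl; exact hba hab
  have h2 : b ≠ c := by rintro rfl; exact hcb hbc
  have h3 : c ≠ a := by rintro rfl; exact hac hca
  intro Z hZ
  rw [← flip_flip, ← flip_flip, outCut_flip_edge, outCut_flip_edge, outCut_flip_edge hab hba]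
  · have := hD Z hZ
    linarith
  · rwa [flip_edge_adj (by grind) (by grind)]
  · rwa [flip_edge_adj (by grind) (by grind)]
  · rwa [flip_edge_adj (by grind) (by grind), flip_edge_adj (by grind) (by grind)]
  · rwa [flip_edge_adj (by grind) (by grind), flip_edge_adj (by grind) (by grind)]

/-- A set of `k + 2` vertices spanning a tournament contains a directed triangle or an arc whose
reversal keeps all cuts large. -/
lemma Strong.exists_flip {k : ℕ} {D : Digraph V} (hD : Strong k D) {N : Finset V}
    (hN : k + 2 ≤ N.card) (hs : ∀ a ∈ N, ∀ b ∈ N, a ≠ b → mult D a b = 1) :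
    ∃ g, Strong k (flip D g) ∧
      ((∃ a ∈ N, ∃ b ∈ N, a ≠ b ∧ g = edge a b) ∨
      ∃ a ∈ N, ∃ b ∈ N, ∃ c ∈ N, a ≠ b ∧ b ≠ c ∧ c ≠ a ∧ g = edge a b + edge b c + edge c a) := by
  have htour : ∀ a ∈ N, ∀ b ∈ N, a ≠ b → (D.Adj a b ↔ ¬ D.Adj b a) := by
    intro a ha b hb hab
    have := hs a ha b hb hab
    simp only [mult, adj_iff_arcWeight] at *
    rcases arcWeight_eq D a b with h | h <;> rcases arcWeight_eq D b a with h' | h' <;> omega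
  by_cases htri : ∃ a ∈ N, ∃ b ∈ N, ∃ c ∈ N, a ≠ b ∧ b ≠ c ∧ c ≠ a ∧
      D.Adj a b ∧ D.Adj b c ∧ D.Adj c a
  · obtain ⟨a, ha, b, hb, c, hc, hab, hbc, hca, h1, h2, h3⟩ := htri
    exact ⟨_, strong_flip_triangle hD h1 ((htour a ha b hb hab).1 h1) h2
      ((htour b hb c hc hbc).1 h2) h3 ((htour c hc a ha hca).1 h3),
      Or.inr ⟨a, ha, b, hb, c, hc, hab, hbc, hca, rfl⟩⟩
  have hne : N.Nonempty := card_pos.1 (by omega)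
  -- Without directed triangles the tournament on `N` is transitive, so extreme out-degrees give a
  -- source `a` and a sink `z`.
  let out : V → Finset V := fun a => N.filter fun v => v ≠ a ∧ D.Adj a v
  have hstrict : ∀ a ∈ N, ∀ b ∈ N, a ≠ b → D.Adj b a → (out a).card < (out b).card := by
    intro a ha b hb hab hba
    refine card_lt_card ⟨fun x hx => ?_, fun h => ?_⟩
    · simp only [out, mem_filter] at hx ⊢
      obtain ⟨hxN, hxa, hax⟩ := hx
      have hxb : x ≠ b := by
        rintro rfl
        exact (htour x hb a ha (Ne.symm hab)).1 hba hax
      refine ⟨hxN, hxb, ?_⟩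
      by_contra hbx
      exact htri ⟨a, ha, x, hxN, b, hb, hxa.symm, hxb, hab.symm, hax,
        (htour x hxN b hb hxb).2 hbx, hba⟩
    · have := h (by simp [out, ha, hab, hba] : a ∈ out b)
      simp [out] at this
  obtain ⟨a, ha, hamax⟩ := exists_max_image N (fun v => (out v).card) hne
  obtain ⟨z, hz, hzmin⟩ := exists_min_image N (fun v => (out v).card) hne
  have haout : ∀ b ∈ N, b ≠ a → D.Adj a b := by
    intro b hb hba
    rw [htour a ha b hb hba.symm]
    intro h
    have := hstrict a ha b hb hba.symm h
    have := hamax b hb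
    omega
  have hzin : ∀ b ∈ N, b ≠ z → D.Adj b z := by
    intro b hb hbz
    rw [htour b hb z hz hbz]
    intro h
    have := hstrict b hb z hz hbz h
    have := hzmin b hb
    omega
  have haz : a ≠ z := by
    rintro rfl
    obtain ⟨b, hb, hba⟩ := exists_mem_ne (by omega : 1 < N.card) a
    exact (htour a ha b hb hba.symm).1 (haout b hb hba) (hzin b hb hba)
  have hadj := haout z hz haz.symm
  have hnadj := (htour a ha z hz haz).1 hadj
  refine ⟨edge a z, fun Z hZ => ?_, Or.inl ⟨a, ha, z, hz, haz, rfl⟩⟩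
  rw [outCut_flip_edge hadj hnadj]
  have h0 := hD Z hZ
  by_cases haZ : a ∈ Z
  · by_cases hzZ : z ∈ Z
    · simp [ind, haZ, hzZ, h0]
    -- Each vertex of `N` gives an arc of the cut, to `z` or from `a`, and only the arc `az` is
    -- counted twice. Hence at least `|N| - 1 ≥ k + 1` arcs leave `Z`, and one may be lost.
    · have h1 := sum_add_sum_le_cutWeight (arcWeight_nonneg D) haZ hzZ
      have h2 : ((N.filter (· ∈ Z)).card : ℤ) ≤ ∑ u ∈ Z, arcWeight D u z := by
        rw [card_eq_sum_ones, Nat.cast_sum]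
        refine le_trans ?_ (sum_le_sum_of_subset_of_nonneg (s := N.filter (· ∈ Z))
          (fun u hu => (mem_filter.1 hu).2) fun u _ _ => arcWeight_nonneg D u z)
        refine sum_le_sum fun u hu => ?_
        obtain ⟨hu, huZ⟩ := mem_filter.1 hu
        have := hzin u hu (by rintro rfl; exact hzZ huZ)
        rw [adj_iff_arcWeight] at this
        simp [this]
      have h3 : ((N.filter (· ∉ Z)).card : ℤ) ≤ ∑ v ∈ Zᶜ, arcWeight D a v := by
        rw [card_eq_sum_ones, Nat.cast_sum]
        refine le_trans ?_ (sum_le_sum_of_subset_of_nonneg (s := N.filter (· ∉ Z))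
          (fun u hu => by simpa using (mem_filter.1 hu).2) fun u _ _ => arcWeight_nonneg D a u)
        refine sum_le_sum fun u hu => ?_
        obtain ⟨hu, huZ⟩ := mem_filter.1 hu
        have := haout u hu (by rintro rfl; exact huZ haZ)
        rw [adj_iff_arcWeight] at this
        simp [this]
      have h4 : (N.filter (· ∈ Z)).card + (N.filter (· ∉ Z)).card = N.card :=
        card_filter_add_card_filter_not _
      have h5 := (adj_iff_arcWeight D a z).1 hadj
      simp only [ind, haZ, hzZ, if_true, if_false, outCut]
      omega
  · simp only [ind, haZ, if_false]
    split_ifs <;> linarith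

/-- `D` can be made strong by inversions of size `p`. -/
def Solvable (k p : ℕ) (D : Digraph V) : Prop := ∃ f ∈ cliqueSpan V p, Strong k (flip D f)

/-- Flips on symmetric pairs of `D₀` do not change `D₀` and can be dropped; restoring the arcs of
`D` outside `D₀` only enlarges cuts. -/
lemma solvable_of_mem_sup {k p : ℕ} {D₀ D : Digraph V} (hD : ∀ u v, D₀.Adj u v → D.Adj u v)
    {f : Sym2 V → ZMod 2} (hf : f ∈ cliqueSpan V p ⊔ edgeSpan (SymPair D₀))
    (hs : Strong k (flip D₀ f)) : Solvable k p D := by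
  obtain ⟨g, hg, h, hh, rfl⟩ := AddSubgroup.mem_sup.1 hf
  rw [add_comm, ← flip_flip, flip_eq_self_of_mem hh] at hs
  exact ⟨g, hg, hs.mono (flip_mono hD g)⟩

section Potential

variable {k p : ℕ} {D₀ D : Digraph V} {T f : Sym2 V → ZMod 2} {q : V → Sym2 V → ZMod 2}

/-- Where `q` is constant modulo `S`, every pair has class `T`, and so does a triangle, since `3T =
T`. A change from `Strong.exists_flip` inside `N` therefore cancels the class of `f`. A symmetric
pair inside `N` would itself put `T` into `S`. -/
lemma solvable_of_class (hD : ∀ u v, D₀.Adj u v → D.Adj u v)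
    (hT : ∀ a b, a ≠ b → edge a b + T + (q a + q b) ∈ cliqueSpan V p)
    (hs : Strong k (flip D₀ f))
    (hf : f + T ∈ cliqueSpan V p ⊔ edgeSpan (SymPair D₀)) {N : Finset V} (hN : k + 2 ≤ N.card)
    (hq : ∀ a ∈ N, ∀ b ∈ N, q a + q b ∈ cliqueSpan V p ⊔ edgeSpan (SymPair D₀)) :
    Solvable k p D := by
  set S := cliqueSpan V p ⊔ edgeSpan (SymPair D₀) with hS
  have hle : cliqueSpan V p ≤ S := le_sup_left
  by_cases hTS : T ∈ S
  · refine solvable_of_mem_sup hD (f := f) ?_ hs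
    have := add_mem hf hTS
    rwa [add_assoc, add_self_pairs, add_zero] at this
  have hedge : ∀ a ∈ N, ∀ b ∈ N, a ≠ b → edge a b + T ∈ S := by
    intro a ha b hb hab
    have := add_mem (hle (hT a b hab)) (hq a ha b hb)
    rwa [add_assoc, add_self_pairs, add_zero] at this
  have hsingle : ∀ a ∈ N, ∀ b ∈ N, a ≠ b → mult (flip D₀ f) a b = 1 := by
    intro a ha b hb hab
    rw [mult_flip]
    by_contra h
    rw [← ne_eq, ← symPair_iff] at h
    have h1 : edge a b ∈ S := (le_sup_right : _ ≤ S) (edge_mem_edgeSpan hab h)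
    have := add_mem h1 (hedge a ha b hb hab)
    rw [← add_assoc, add_self_pairs, zero_add] at this
    exact hTS this
  obtain ⟨g, hg, hgN⟩ := hs.exists_flip hN hsingle
  have hgT : g + T ∈ S := by
    rcases hgN with ⟨a, ha, b, hb, hab, rfl⟩ | ⟨a, ha, b, hb, c, hc, hab, hbc, hca, rfl⟩
    · exact hedge a ha b hb hab
    · have := add_mem (add_mem (hedge a ha b hb hab) (hedge b hb c hc hbc)) (hedge c hc a ha hca)
      convert this using 1
      linear_combination - add_self_pairs T
  rw [flip_flip] at hg
  refine solvable_of_mem_sup hD ?_ hg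
  have := add_mem hf hgT
  convert this using 1
  linear_combination - add_self_pairs T

/-- A symmetric pair `ab` lies in `S`, so `q a` and `q b` differ by `T`. As symmetric pairs connect
`C`, the potential takes at most two values on `C`. -/
lemma potential_class (hT : ∀ a b, a ≠ b → edge a b + T + (q a + q b) ∈ cliqueSpan V p)
    {C : Finset V} {o : V} (ho : o ∈ C)
    (hC : ∀ P ⊆ C, P.Nonempty → (∀ a ∈ P, ∀ b ∈ C, b ∉ P → mult D₀ a b = 1) → P = C) :
    ∀ a ∈ C, q o + q a ∈ cliqueSpan V p ⊔ edgeSpan (SymPair D₀) ∨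
      q o + q a + T ∈ cliqueSpan V p ⊔ edgeSpan (SymPair D₀) := by
  set S := cliqueSpan V p ⊔ edgeSpan (SymPair D₀) with hS
  have hcover : C.filter (fun a => q o + q a ∈ S ∨ q o + q a + T ∈ S) = C := by
    refine hC _ (filter_subset _ _) ⟨o, by simp [add_self_pairs, ho]⟩ fun a ha b hbC hb => ?_
    by_contra h
    rw [← ne_eq, ← symPair_iff] at h
    have hab : a ≠ b := by rintro rfl; exact hb ha
    have h1 : edge a b ∈ S := (le_sup_right : _ ≤ S) (edge_mem_edgeSpan hab h)
    have h2 := add_mem h1 ((le_sup_left : _ ≤ S) (hT a b hab))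
    simp only [mem_filter, hbC, true_and, not_or] at ha hb
    rcases ha.2 with ha | ha
    · refine hb.2 ?_
      convert add_mem ha h2 using 1
      linear_combination - add_self_pairs (q a) - add_self_pairs (edge a b)
    · refine hb.1 ?_
      convert add_mem ha h2 using 1
      linear_combination - add_self_pairs (q a) - add_self_pairs (edge a b) - add_self_pairs T
  intro a ha
  rw [← hcover] at ha
  exact (mem_filter.1 ha).2

lemma edge_mem_or {S : AddSubgroup (Sym2 V → ZMod 2)} {a b : V} {α β : Sym2 V → ZMod 2}
    (h : edge a b + T + (q a + q b) ∈ S) (ha : α + q a ∈ S ∨ α + q a + T ∈ S)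
    (hb : β + q b ∈ S ∨ β + q b + T ∈ S) :
    edge a b + (α + β) ∈ S ∨ edge a b + (α + β) + T ∈ S := by
  have e1 := add_self_pairs (q a)
  have e2 := add_self_pairs (q b)
  have e4 := add_self_pairs T
  rcases ha with ha | ha <;> rcases hb with hb | hb
  · right
    convert add_mem h (add_mem ha hb) using 1
    linear_combination - e1 - e2
  · left
    convert add_mem h (add_mem ha hb) using 1
    linear_combination - e1 - e2 - e4
  · left
    convert add_mem h (add_mem ha hb) using 1
    linear_combination - e1 - e2 - e4
  · right
    convert add_mem h (add_mem ha hb) using 1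
    linear_combination - e1 - e2 - e4

/-- The classes `0` and `T` are closed under addition, so generators suffice. The map `z` carries
the correction left by pairs whose ends have different reference potentials. -/
lemma mem_or_of_edgeSpan {S : AddSubgroup (Sym2 V → ZMod 2)} {K : V → V → Prop}
    (z : (Sym2 V → ZMod 2) →+ (Sym2 V → ZMod 2))
    (h : ∀ a b, a ≠ b → K a b → edge a b + z (edge a b) ∈ S ∨ edge a b + z (edge a b) + T ∈ S)
    (hf : f ∈ edgeSpan K) : f + z f ∈ S ∨ f + z f + T ∈ S := by
  induction hf using AddSubgroup.closure_induction with
  | mem f hf =>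
    obtain ⟨a, b, hab, hK, rfl⟩ := hf
    exact h a b hab hK
  | zero => left; simp
  | add f g _ _ hf hg =>
    rw [map_add]
    rcases hf with hf | hf <;> rcases hg with hg | hg
    · left; convert add_mem hf hg using 1; ring
    · right; convert add_mem hf hg using 1; ring
    · right; convert add_mem hf hg using 1; ring
    · left; convert add_mem hf hg using 1; linear_combination - add_self_pairs T
  | neg f _ hf => rwa [neg_pairs]

end Potential

/-! ### Connecting the vertices by symmetric pairs. -/

/-- No pair leaving `P` is empty or a digon. -/
def ClosedSet (D : Digraph V) (P : Finset V) : Prop := ∀ a ∈ P, ∀ b ∉ P, mult D a b = 1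

lemma exists_large_class {P Q N : Finset V} (h : N ⊆ P ∪ Q) {m : ℕ} (hm : 2 * m - 1 ≤ N.card) :
    m ≤ (N ∩ P).card ∨ m ≤ (N ∩ Q).card := by
  have h1 : N = (N ∩ P) ∪ (N ∩ Q) := by
    rw [← inter_union_distrib_left, inter_eq_left.2 h]
  have h2 := card_union_le (N ∩ P) (N ∩ Q)
  rw [← h1] at h2
  omega

/-- If the empty pairs and digons connect all vertices, then inversions suffice. -/
lemma solvable_of_connected {k p : ℕ} {D₀ D : Digraph V} (hk : 1 ≤ k) (hp : 2 ≤ p)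
    (hpn : p + 2 ≤ Fintype.card V) (hkn : 4 * k + 2 ≤ Fintype.card V)
    (hD : ∀ u v, D₀.Adj u v → D.Adj u v) (hcut : LargeCuts k D₀)
    (hconn : ∀ P : Finset V, P.Nonempty → ClosedSet D₀ P → P = univ) : Solvable k p D := by
  obtain ⟨T, q, hT⟩ := exists_potential hp hpn
  obtain ⟨D', hsame, hs⟩ := hcut.exists_strong
  obtain ⟨f, hf, rfl⟩ := hsame.exists_flip _ _ rfl
  set S := cliqueSpan V p ⊔ edgeSpan (SymPair D₀) with hS
  have hle : cliqueSpan V p ≤ S := le_sup_left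
  obtain ⟨o⟩ : Nonempty V := Fintype.card_pos_iff.1 (by omega)
  have hclass := potential_class (D₀ := D₀) hT (mem_univ o) fun P _ hP hcl =>
    hconn P hP fun a ha b hb => hcl a ha b (mem_univ b) hb
  have hcover : (univ : Finset V) =
      univ.filter (fun a => q o + q a ∈ S) ∪ univ.filter (fun a => q o + q a + T ∈ S) := by
    rw [← filter_or, eq_comm, filter_eq_self]
    exact hclass
  have hfS := mem_or_of_edgeSpan (S := S) (T := T) 0 (fun a b hab _ => by
    have := edge_mem_or (hle (hT a b hab)) (hclass a (mem_univ a)) (hclass b (mem_univ b))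
    rwa [add_self_pairs] at this) hf
  rw [AddMonoidHom.zero_apply, add_zero] at hfS
  rcases hfS with hfS | hfS
  · exact solvable_of_mem_sup hD hfS hs
  -- The larger of the two potential classes has `k + 2` vertices because `2 * (k + 2) - 1 ≤ 4 * k +
  -- 2` for `k ≥ 1`.
  rcases exists_large_class (N := univ) (m := k + 2) hcover.subset (by rw [card_univ]; omega)
    with h | h
  · refine solvable_of_class hD hT hs hfS h fun a ha b hb => ?_
    simp only [mem_inter, mem_filter, mem_univ, true_and] at ha hb
    convert add_mem ha hb using 1
    linear_combination - add_self_pairs (q o)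
  · refine solvable_of_class hD hT hs hfS h fun a ha b hb => ?_
    simp only [mem_inter, mem_filter, mem_univ, true_and] at ha hb
    convert add_mem ha hb using 1
    linear_combination - add_self_pairs (q o) - add_self_pairs T

lemma mult_of_adj_iff {V : Type*} {D₀ D : Digraph V} {u v : V}
    (h : D₀.Adj u v ↔ D.Adj u v) (h' : D₀.Adj v u ↔ D.Adj v u) : mult D₀ u v = mult D u v := by
  simp only [mult, arcWeight, h, h']

lemma mult_eq_zero {V : Type*} {D : Digraph V} {u v : V}
    (h : ¬ D.Adj u v) (h' : ¬ D.Adj v u) : mult D u v = 0 := by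
  simp [mult, arcWeight, h, h']

lemma cutWeight_ite_mem (Q Z : Finset V) :
    cutWeight (fun u v => if u ∈ Q ∧ v ∈ Q then 1 else 0) Z = (Q ∩ Z).card * (Q \ Z).card := by
  have h : ∀ u v, (if u ∈ Z ∧ v ∉ Z then (if u ∈ Q ∧ v ∈ Q then (1 : ℤ) else 0) else 0) =
      (if u ∈ Q ∩ Z then 1 else 0) * (if v ∈ Q \ Z then 1 else 0) := by
    intro u v
    by_cases h1 : u ∈ Z <;> by_cases h2 : u ∈ Q <;> by_cases h3 : v ∈ Z <;>
      by_cases h4 : v ∈ Q <;> simp [h1, h2, h3, h4]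
  simp only [cutWeight, h, ← mul_sum, ← sum_mul, sum_boole]
  congr 3 <;> (ext; simp)

/-- If the vertices are grouped such that all pairs between different groups are single arcs and
no group is too large, then inversions suffice. -/
lemma solvable_of_groups {ι : Type*} {k p : ℕ} {D : Digraph V} (hk : 1 ≤ k) (hp : 2 ≤ p)
    (hpn : p + 2 ≤ Fintype.card V) (hkn : 4 * k + 2 ≤ Fintype.card V) (g : V → ι) (Q : Finset V)
    (hQ3 : Q.card ≤ 3) (hQ : ∀ v, ∃ z ∈ Q, g z = g v) (hg : ∀ u v, g u ≠ g v → mult D u v = 1)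
    (hsize : ∀ u, ∃ G : Finset V, (∀ v ∈ G, g v ≠ g u) ∧ 2 * k + Q.card ≤ G.card + 1) :
    Solvable k p D := by
  -- Emptying the pairs inside groups connects each group; emptying those among the representatives
  -- `Q` connects the groups to each other.
  let D₀ : Digraph V := ⟨fun u v => D.Adj u v ∧ g u ≠ g v ∧ ¬ (u ∈ Q ∧ v ∈ Q)⟩
  have hm0 : ∀ u v, g u = g v → mult D₀ u v = 0 := fun u v h =>
    mult_eq_zero (by simp [D₀, h]) (by simp [D₀, h])
  have hmQ : ∀ u v, u ∈ Q → v ∈ Q → mult D₀ u v = 0 := fun u v h h' =>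
    mult_eq_zero (by simp [D₀, h, h']) (by simp [D₀, h, h'])
  have hm1 : ∀ u v, g u ≠ g v → ¬ (u ∈ Q ∧ v ∈ Q) → mult D₀ u v = 1 := by
    intro u v h h'
    rw [← hg u v h]
    exact mult_of_adj_iff (by simp [D₀, h, h']) (by simp [D₀, Ne.symm h, and_comm.not.1 h'])
  set y : V → V → ℤ := fun u v => if g u ≠ g v then 1 else 0 with hy
  have hy0 : ∀ u v, 0 ≤ y u v := by
    intro u v
    simp only [hy]
    split_ifs <;> simp
  obtain ⟨o⟩ : Nonempty V := Fintype.card_pos_iff.1 (by omega)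
  have hQ1 : 1 ≤ Q.card := by
    obtain ⟨z, hz, -⟩ := hQ o
    exact card_pos.2 ⟨z, hz⟩
  have hycut : ∀ Z, Proper Z → 2 * (k : ℤ) + Q.card - 1 ≤ cutWeight y Z := by
    intro Z hZ
    -- If `Z` splits a group, each vertex outside that group sends an edge of the cut to `a` or `b`.
    -- Otherwise `Z` is a union of groups, and its cut has at least `|Z| + |Zᶜ| - 1` edges.
    by_cases hsplit : ∃ a ∈ Z, ∃ b ∉ Z, g a = g b
    · obtain ⟨a, ha, b, hb, hab⟩ := hsplit
      have h1 := sum_add_sum_le_cutWeight hy0 ha hb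
      have h2 : y a b = 0 := by simp [hy, hab]
      have h3 : ∑ u ∈ Z, y u b + ∑ v ∈ Zᶜ, y a v = ((univ.filter fun v => g v ≠ g a).card : ℤ) := by
        rw [card_filter, Nat.cast_sum, ← sum_add_sum_compl Z]
        congr 1
        · refine sum_congr rfl fun u _ => ?_
          simp [hy, hab]
        · refine sum_congr rfl fun u _ => ?_
          simp [hy, eq_comm]
      obtain ⟨G, hG, hGk⟩ := hsize a
      have h4 : G ⊆ univ.filter fun v => g v ≠ g a :=
        fun v hv => mem_filter.2 ⟨mem_univ v, hG v hv⟩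
      have := card_le_card h4
      omega
    · push Not at hsplit
      obtain ⟨a, ha⟩ := hZ.1
      obtain ⟨b, hb⟩ := hZ.exists_notMem
      have h1 := sum_add_sum_le_cutWeight hy0 ha hb
      have h2 : y a b = 1 := by simp [hy, hsplit a ha b hb]
      have h3 : ∑ u ∈ Z, y u b = Z.card := by
        rw [card_eq_sum_ones, Nat.cast_sum]
        exact sum_congr rfl fun u hu => by simp [hy, hsplit u hu b hb]
      have h4 : ∑ v ∈ Zᶜ, y a v = Zᶜ.card := by
        rw [card_eq_sum_ones, Nat.cast_sum]
        exact sum_congr rfl fun v hv => by simp [hy, hsplit a ha v (by simpa using hv)]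
      have h5 := card_add_card_compl Z
      omega
  have hcut : LargeCuts k D₀ := by
    intro Z hZ
    have h1 := hycut Z hZ
    have h2 : cutWeight y Z ≤
        cutWeight (fun u v => mult D₀ u v + if u ∈ Q ∧ v ∈ Q then 1 else 0) Z := by
      refine cutWeight_mono fun u _ v _ => ?_
      have h0 := mult_nonneg D₀ u v
      have := hm1 u v
      simp only [hy]
      split_ifs <;> simp_all
    rw [cutWeight_add, cutWeight_ite_mem] at h2
    have h3 : (Q ∩ Z).card + (Q \ Z).card = Q.card := card_inter_add_card_sdiff Q Z
    -- The edges lost among the representatives number `m * n`, which is at most `m + n - 1` when `1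
    -- ≤ m + n ≤ 3`; this is where `Q.card ≤ 3` is needed.
    have h4 : (Q ∩ Z).card * (Q \ Z).card ≤ Q.card - 1 := by
      have h5 : (Q ∩ Z).card ≤ 3 := by omega
      have h6 : (Q \ Z).card ≤ 3 := by omega
      rw [← h3] at hQ1 hQ3 ⊢
      generalize (Q ∩ Z).card = m at *
      generalize (Q \ Z).card = n at *
      interval_cases m <;> interval_cases n <;> omega
    have h7 : ((Q ∩ Z).card : ℤ) * (Q \ Z).card ≤ Q.card - 1 := by
      have : (((Q ∩ Z).card * (Q \ Z).card : ℕ) : ℤ) ≤ ((Q.card - 1 : ℕ) : ℤ) := by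
        exact_mod_cast h4
      push_cast [hQ1] at this
      exact this
    simp only [totalCut]
    linarith
  refine solvable_of_connected hk hp hpn hkn (D₀ := D₀) (fun u v h => h.1) hcut ?_
  rintro P ⟨a, ha⟩ hP
  have hgrp : ∀ u ∈ P, ∀ v, g u = g v → v ∈ P := by
    intro u hu v huv
    by_contra hv
    have := hP u hu v hv
    rw [hm0 u v huv] at this
    simp at this
  have hQP : ∀ u ∈ P, u ∈ Q → ∀ v ∈ Q, v ∈ P := by
    intro u hu huQ v hvQ
    by_contra hv
    have := hP u hu v hv
    rw [hmQ u v huQ hvQ] at this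
    simp at this
  obtain ⟨z, hz, hza⟩ := hQ a
  rw [eq_univ_iff_forall]
  intro v
  obtain ⟨z', hz', hzv⟩ := hQ v
  exact hgrp z' (hQP z (hgrp a ha z hza.symm) hz z' hz') v hzv

/-! ### Connectivity and inversions in terms of cuts and flips. -/

section Bridge

open scoped Graph

/-- The arcs of `D` leaving `Z`. -/
noncomputable def outArcs (D : Digraph V) (Z : Finset V) : Finset (V × V) :=
  univ.filter fun a => D.Adj a.1 a.2 ∧ a.1 ∈ Z ∧ a.2 ∉ Z

lemma outCut_eq_card (D : Digraph V) (Z : Finset V) : outCut D Z = (outArcs D Z).card := by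
  rw [outArcs, card_filter, Nat.cast_sum, Fintype.sum_prod_type]
  refine sum_congr rfl fun u _ => sum_congr rfl fun v _ => ?_
  simp only [arcWeight]
  split_ifs <;> simp_all

lemma totalCut_eq_card (D : Digraph V) (Z : Finset V) :
    totalCut D Z = (outArcs D Z ∪ outArcs D Zᶜ).card := by
  rw [card_union_of_disjoint, Nat.cast_add, ← outCut_eq_card, ← outCut_eq_card, totalCut_eq]
  rw [disjoint_left]
  intro a ha ha'
  simp only [outArcs, mem_filter, mem_univ, true_and, mem_compl] at ha ha'
  exact ha'.2.1 ha.2.1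

lemma outDegree_coe (D : Digraph V) (Z : Finset V) : (outDegree D (Z : Set V) : ℤ) = outCut D Z := by
  rw [outCut_eq_card, outDegree, ← Set.ncard_coe_finset]
  congr 2
  ext a
  simp [outArcs, arcSet]

lemma cut_coe (D : Digraph V) (Z : Finset V) :
    cut (underlyingGraph D) (Z : Set V) = ↑(outArcs D Z ∪ outArcs D Zᶜ) := by
  ext ⟨a, b⟩
  simp only [cut, underlyingGraph, outArcs, Set.mem_ofPred_eq, coe_union, Set.mem_union, mem_coe,
    mem_filter, mem_univ, true_and, mem_compl, Prod.mk.injEq]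
  constructor
  · rintro ⟨u, hu, v, hv, h, ⟨rfl, rfl⟩ | ⟨rfl, rfl⟩⟩
    · exact Or.inl ⟨h, hu, hv⟩
    · exact Or.inr ⟨h, hv, by simpa using hu⟩
  · rintro (⟨h, hu, hv⟩ | ⟨h, hu, hv⟩)
    · exact ⟨a, hu, b, hv, h, Or.inl ⟨rfl, rfl⟩⟩
    · exact ⟨b, by simpa using hv, a, hu, h, Or.inr ⟨rfl, rfl⟩⟩

lemma cutSize_coe (D : Digraph V) (Z : Finset V) :
    (cutSize (underlyingGraph D) (Z : Set V) : ℤ) = totalCut D Z := by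
  rw [cutSize, cut_coe, Set.ncard_coe_finset, totalCut_eq_card]

lemma existsUnique_isLink_iff {V : Type*} (D : Digraph V) {x y : V} (hxy : x ≠ y) :
    (∃! e, (underlyingGraph D).IsLink e x y) ↔ mult D x y = 1 := by
  have hne : (x, y) ≠ (y, x) := by simp [hxy]
  have h : ∀ e, (underlyingGraph D).IsLink e x y ↔
      (e = (x, y) ∧ D.Adj x y) ∨ (e = (y, x) ∧ D.Adj y x) := by
    intro e
    simp only [underlyingGraph]
    constructor
    · rintro ⟨h1, rfl | rfl⟩
      · exact Or.inl ⟨rfl, h1⟩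
      · exact Or.inr ⟨rfl, h1⟩
    · rintro (⟨rfl, h⟩ | ⟨rfl, h⟩)
      · exact ⟨h, Or.inl rfl⟩
      · exact ⟨h, Or.inr rfl⟩
  simp only [h, mult, arcWeight, ExistsUnique]
  by_cases h1 : D.Adj x y <;> by_cases h2 : D.Adj y x
  · simp only [h1, h2, and_true, if_true]
    refine iff_of_false ?_ (by norm_num)
    rintro ⟨e, -, he⟩
    exact hne ((he _ (Or.inl rfl)).trans (he _ (Or.inr rfl)).symm)
  · simp [h1, h2]
  · simp [h1, h2]
  · simp [h1, h2]

lemma mem_of_reflTransGen {α : Type*} {r : α → α → Prop} {Z : Set α} (h : ∀ a ∈ Z, ∀ b, r a b → b ∈ Z)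
    {a b : α} (hab : Relation.ReflTransGen r a b) (ha : a ∈ Z) : b ∈ Z := by
  induction hab with
  | refl => exact ha
  | tail _ hbc ih => exact h _ ih _ hbc

lemma largeCuts_of_edgeConnected {D : Digraph V} {k : ℕ} (h : DigraphEdgeConnected D (2 * k)) :
    LargeCuts k D := by
  intro Z hZ
  by_contra hlt
  rw [totalCut_eq_card] at hlt
  obtain ⟨u, hu⟩ := hZ.1
  obtain ⟨v, hv⟩ := hZ.exists_notMem
  have hcon := h (outArcs D Z ∪ outArcs D Zᶜ) (by
    rw [← cut_coe]
    rintro e ⟨x, -, y, -, hl⟩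
    exact hl.edge_mem) (by omega) u (Set.mem_univ u) v (Set.mem_univ v)
  refine hv (mem_of_reflTransGen (Z := (Z : Set V)) (fun a ha b hab => ?_) hcon hu)
  by_contra hb
  obtain ⟨e, he⟩ := hab
  rw [Graph.deleteEdges_isLink, ← cut_coe] at he
  exact he.2 ⟨a, ha, b, hb, he.1⟩

lemma arcStrong_iff {D : Digraph V} {k : ℕ} : ArcStrong D k ↔ Strong k D := by
  constructor
  · intro h Z hZ
    by_contra hlt
    rw [outCut_eq_card] at hlt
    obtain ⟨u, hu⟩ := hZ.1
    obtain ⟨v, hv⟩ := hZ.exists_notMem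
    have hcon := h (outArcs D Z) (by
      intro a ha
      simp only [outArcs, coe_filter, Set.mem_ofPred_eq] at ha
      exact ha.2.1) (by omega) u v
    refine hv (mem_of_reflTransGen (Z := (Z : Set V)) (fun a ha b hab => ?_) hcon hu)
    by_contra hb
    refine hab.2 ?_
    simp only [outArcs, coe_filter, Set.mem_ofPred_eq, mem_univ, true_and]
    exact ⟨hab.1, ha, hb⟩
  · intro h F hF hFk u v
    by_contra huv
    set Z : Finset V := univ.filter fun x =>
      Relation.ReflTransGen (deleteArcs D (F : Set (V × V))).Adj u x with hZ
    have hu : u ∈ Z := by simp [hZ, Relation.ReflTransGen.refl]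
    have hv : v ∉ Z := by simpa [hZ] using huv
    have h1 := h Z (proper_of_mem hu hv)
    rw [outCut_eq_card] at h1
    have h2 : outArcs D Z ⊆ F := by
      rintro ⟨a, b⟩ hab
      simp only [outArcs, mem_filter, mem_univ, true_and, hZ] at hab
      by_contra hF'
      exact hab.2.2 (hab.2.1.tail ⟨hab.1, by simpa using hF'⟩)
    have := card_le_card h2
    omega

lemma invertible_iff_solvable {D : Digraph V} {k p : ℕ} : Invertible k p D ↔ Solvable k p D := by
  constructor
  · rintro ⟨L, hL, hs⟩
    rw [arcStrong_iff, invertAll_eq_flip] at hs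
    refine ⟨_, list_sum_mem fun f hf => ?_, hs⟩
    obtain ⟨X, hX, rfl⟩ := List.mem_map.1 hf
    exact AddSubgroup.subset_closure ⟨X, hL X hX, rfl⟩
  · rintro ⟨f, hf, hs⟩
    obtain ⟨L, hL, rfl⟩ := exists_list_of_mem_cliqueSpan hf
    refine ⟨L, hL, ?_⟩
    rwa [arcStrong_iff, invertAll_eq_flip]

end Bridge

/-! ### The parity invariant and necessity. -/

section Parity

/-- The parity of the number of pairs between `X` and its complement on which `f` is `1`. -/
noncomputable def crossing (X : Finset V) : (Sym2 V → ZMod 2) →+ ZMod 2 where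
  toFun f := ∑ u ∈ X, ∑ v ∈ Xᶜ, f s(u, v)
  map_zero' := by simp
  map_add' f g := by simp [sum_add_distrib]

lemma crossing_apply (X : Finset V) (f : Sym2 V → ZMod 2) :
    crossing X f = ∑ u ∈ X, ∑ v ∈ Xᶜ, f s(u, v) := rfl

lemma crossing_edge (X : Finset V) {a b : V} (hab : a ≠ b) :
    crossing X (edge a b) = if (a ∈ X ↔ b ∈ X) then 0 else 1 := by
  simp only [crossing_apply, edge_apply hab, sum_add_distrib, ← mul_sum, ← sum_mul, sum_ite_eq',
    mem_compl]
  by_cases h1 : a ∈ X <;> by_cases h2 : b ∈ X <;> simp [h1, h2]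

/-- A clique on `P` has `|P ∩ X| * |P \ X|` crossing pairs, and for odd `|P|` one factor is even. -/
lemma crossing_eq_zero {p : ℕ} (hodd : Odd p) (X : Finset V) {f : Sym2 V → ZMod 2}
    (hf : f ∈ cliqueSpan V p) : crossing X f = 0 := by
  induction hf using AddSubgroup.closure_induction with
  | mem f hf =>
    obtain ⟨P, hP, rfl⟩ := hf
    have h1 : crossing X (clique P) = (((P ∩ X).card * (P \ X).card : ℕ) : ZMod 2) := by
      simp only [crossing_apply, clique_apply, ← mul_sum, ← sum_mul, sum_boole, Nat.cast_mul]
      congr 3 <;> (ext; simp [and_comm])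
    rw [h1, ZMod.natCast_eq_zero_iff_even, Nat.even_mul]
    have h2 : (P ∩ X).card + (P \ X).card = P.card := card_inter_add_card_sdiff P X
    by_contra! h
    rw [Nat.not_even_iff_odd, Nat.not_even_iff_odd] at h
    have := h.1.add_odd h.2
    rw [h2, hP] at this
    exact (Nat.not_even_iff_odd.2 hodd) this
  | zero => exact map_zero _
  | add f g _ _ hf hg => rw [map_add, hf, hg, add_zero]
  | neg f _ hf => rwa [neg_pairs]

/-- Each crossing pair carries exactly one arc, so each flipped crossing pair changes the out-degree
by one. -/
lemma outCut_flip_cast {D : Digraph V} {X : Finset V} (hX : ClosedSet D X) (f : Sym2 V → ZMod 2) :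
    (outCut (flip D f) X : ZMod 2) = outCut D X + crossing X f := by
  have h : ∀ E : Digraph V, (outCut E X : ZMod 2) =
      ∑ u ∈ X, ∑ v ∈ Xᶜ, (arcWeight E u v : ZMod 2) := by
    intro E
    simp only [outCut, cutWeight, Int.cast_sum, Int.cast_ite, Int.cast_zero, ite_and]
    rw [← sum_filter_add_sum_filter_not univ (· ∈ X),
      sum_eq_zero (s := univ.filter (· ∉ X)), add_zero]
    · refine sum_congr (by ext; simp) fun u hu => ?_
      have hu : u ∈ X := by simpa using hu
      simp only [hu, if_true]
      rw [← sum_filter]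
      exact sum_congr (by ext; simp) fun _ _ => rfl
    · intro u hu
      have hu : u ∉ X := by simpa using hu
      simp [hu]
  rw [h, h, crossing_apply, ← sum_add_distrib]
  refine sum_congr rfl fun u hu => ?_
  rw [← sum_add_distrib]
  refine sum_congr rfl fun v hv => ?_
  have h1 := hX u hu v (by simpa using hv)
  simp only [mult] at h1
  have h2 : arcWeight (flip D f) u v = if f s(u, v) = 1 then arcWeight D v u else
      arcWeight D u v := by
    simp only [arcWeight, flip]
    rcases zmod_two (f s(u, v)) with h | h <;> simp [h]
  rw [h2]
  rcases zmod_two (f s(u, v)) with h | h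
  · simp [h]
  · rw [if_pos h, h]
    rcases arcWeight_eq D u v with h3 | h3
    · rw [show arcWeight D v u = 1 by omega, h3]; simp
    · rw [show arcWeight D v u = 0 by omega, h3]; decide

lemma totalCut_of_closedSet {D : Digraph V} {X : Finset V} (hX : ClosedSet D X) :
    totalCut D X = X.card * Xᶜ.card := by
  have h := cutWeight_ite_mem univ X
  rw [univ_inter, ← compl_eq_univ_sdiff] at h
  rw [← h]
  exact cutWeight_congr fun u hu v hv => by simp [hX u hu v hv]

/-- If a closed set is partitioned into sets with minimal cuts, then every strong reorientation is
balanced on it. -/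
lemma two_mul_outCut_eq {k : ℕ} {D D' : Digraph V} (hsame : SameMult D' D) (hs : Strong k D')
    {ι : Type*} {s : Finset ι} {P : ι → Finset V} (hprop : ∀ i ∈ s, Proper (P i))
    (hdisj : (s : Set ι).PairwiseDisjoint P) (hcut : ∀ i ∈ s, totalCut D (P i) = 2 * k)
    (hX : ClosedSet D (s.biUnion P)) :
    2 * outCut D' (s.biUnion P) = (s.biUnion P).card * (s.biUnion P)ᶜ.card := by
  rw [← totalCut_of_closedSet hX, ← hsame.totalCut_eq, totalCut_eq]
  have h := cutWeight_sub_compl (arcWeight D') (s.biUnion P)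
  rw [sum_biUnion hdisj, sum_eq_zero] at h
  · simp only [outCut]
    linarith
  · intro i hi
    rw [← cutWeight_sub_compl]
    have h1 := hs _ (hprop i hi)
    have h2 := hs _ (hprop i hi).compl
    have h3 := hcut i hi
    rw [← hsame.totalCut_eq, totalCut_eq] at h3
    simp only [outCut] at *
    omega

theorem not_solvable_of_isObstruction {k p : ℕ} {D : Digraph V} (hodd : Odd p)
    (hobs : IsObstruction k D) : ¬ Solvable k p D := by
  rintro ⟨f, hf, hs⟩
  obtain ⟨r, P, X, Y, hP, hY, hdisj, hXP, hXY, hXYu, hcut, huniq, m, hm, hmX⟩ := hobs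
  set Q : Fin r → Finset V := fun i => (P i).toFinset with hQ
  have hQP : ∀ i, (Q i : Set V) = P i := fun i => by simp [hQ]
  set U : Finset V := univ.biUnion Q with hU
  have hUX : (U : Set V) = X := by
    rw [hXP, hU]
    simp [hQP]
  have hUY : ((Uᶜ : Finset V) : Set V) = Y := by
    rw [coe_compl, hUX]
    exact (isCompl_iff.2 ⟨hXY, codisjoint_iff.2 hXYu⟩).compl_eq
  have hclosed : ClosedSet D U := by
    intro x hx y hy
    have hne : x ≠ y := by rintro rfl; exact hy hx
    rw [← existsUnique_isLink_iff D hne]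
    refine huniq x (by rw [← hUX]; exact hx) y ?_
    rw [← hUY]
    simpa using hy
  have hprop : ∀ i, Proper (Q i) := by
    intro i
    obtain ⟨x, hx⟩ := hP i
    obtain ⟨y, hy⟩ := hY
    refine proper_of_mem (u := x) (v := y) (by simpa [hQ] using hx) fun h => ?_
    have h1 : y ∈ U := mem_biUnion.2 ⟨i, mem_univ i, h⟩
    rw [← hUY] at hy
    simp [h1] at hy
  have hbal := two_mul_outCut_eq (mult_flip D f) hs (s := univ) (P := Q) (fun i _ => hprop i)
    (fun i _ j _ hij => by
      have := hdisj i j hij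
      rw [← hQP, ← hQP, disjoint_coe] at this
      exact this) (fun i _ => by rw [← cutSize_coe, hQP, hcut]; simp) hclosed
  have hpar := outCut_flip_cast hclosed f
  rw [crossing_eq_zero hodd U hf, add_zero] at hpar
  rw [← hUX, ← hUY, Set.ncard_coe_finset, Set.ncard_coe_finset] at hmX
  have hq : ((outDegree D (U : Set V) : ℤ) : ℚ) = outCut D U := by rw [outDegree_coe]
  rw [Int.cast_natCast] at hq
  rw [hq] at hmX
  have hbal' : 2 * (outCut (flip D f) U : ℚ) = U.card * Uᶜ.card := by exact_mod_cast hbal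
  have hmeq : (m : ℚ) = ((outCut D U - outCut (flip D f) U : ℤ) : ℚ) := by
    push_cast
    linarith
  have hmeq' : m = outCut D U - outCut (flip D f) U := by exact_mod_cast hmeq
  have : (m : ZMod 2) = 0 := by rw [hmeq', Int.cast_sub, hpar, sub_self]
  rw [ZMod.intCast_eq_zero_iff_even] at this
  exact (Int.not_even_iff_odd.2 hm) this

end Parity

/-! ### Sets with minimal cuts, and building an obstruction. -/

lemma totalCut_submodular (D : Digraph V) (A B : Finset V) :
    totalCut D (A ∩ B) + totalCut D (A ∪ B) ≤ totalCut D A + totalCut D B :=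
  cutWeight_submodular (mult_nonneg D) A B

/-- The maximal sets with minimal cuts inside `C` partition `C` if they cover it. -/
lemma exists_partition {k : ℕ} {D : Digraph V} (hD : LargeCuts k D) {C : Finset V}
    (hC : Cᶜ.Nonempty) (hcov : ∀ u ∈ C, ∃ A ⊆ C, u ∈ A ∧ totalCut D A = 2 * k) :
    ∃ M : Finset (Finset V), M.biUnion id = C ∧ (M : Set (Finset V)).PairwiseDisjoint id ∧
      ∀ A ∈ M, A.Nonempty ∧ A ⊆ C ∧ totalCut D A = 2 * k := by
  obtain ⟨y, hy⟩ := hC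
  rw [mem_compl] at hy
  have hunion : ∀ A B, A ⊆ C → B ⊆ C → totalCut D A = 2 * k → totalCut D B = 2 * k →
      (∃ x ∈ A, x ∈ B) → totalCut D (A ∪ B) = 2 * k := by
    rintro A B hA hB hAk hBk ⟨x, hxA, hxB⟩
    have h1 := totalCut_submodular D A B
    have hyA : y ∉ A := fun h => hy (hA h)
    have hyB : y ∉ B := fun h => hy (hB h)
    have h2 := hD (A ∩ B) (proper_of_mem (u := x) (v := y) (by simp [hxA, hxB]) (by simp [hyA]))
    have h3 := hD (A ∪ B) (proper_of_mem (u := x) (v := y) (by simp [hxA]) (by simp [hyA, hyB]))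
    omega
  refine ⟨univ.filter fun A => (A.Nonempty ∧ A ⊆ C ∧ totalCut D A = 2 * k) ∧
    ∀ B ⊆ C, totalCut D B = 2 * k → A ⊆ B → A = B, ?_, ?_, fun A hA => (mem_filter.1 hA).2.1⟩
  · ext u
    simp only [mem_biUnion, mem_filter, mem_univ, true_and, id]
    constructor
    · rintro ⟨A, ⟨⟨-, hA, -⟩, -⟩, hu⟩
      exact hA hu
    · intro hu
      obtain ⟨A₀, hA₀, huA₀, hA₀k⟩ := hcov u hu
      obtain ⟨A, hA, hmax⟩ := exists_max_image
        (univ.filter fun A : Finset V => A ⊆ C ∧ u ∈ A ∧ totalCut D A = 2 * k) card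
        ⟨A₀, mem_filter.2 ⟨mem_univ _, hA₀, huA₀, hA₀k⟩⟩
      simp only [mem_filter, mem_univ, true_and] at hA hmax
      exact ⟨A, ⟨⟨⟨u, hA.2.1⟩, hA.1, hA.2.2⟩, fun B hB hBk hAB =>
        eq_of_subset_of_card_le hAB (hmax B ⟨hB, hAB hA.2.1, hBk⟩)⟩, hA.2.1⟩
  · intro A hA B hB hAB
    simp only [coe_filter, Set.mem_ofPred_eq, mem_univ, true_and] at hA hB
    simp only [Function.onFun, id]
    rw [disjoint_left]
    intro x hxA hxB
    have hu := hunion A B hA.1.2.1 hB.1.2.1 hA.1.2.2 hB.1.2.2 ⟨x, hxA, hxB⟩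
    have h1 := hA.2 (A ∪ B) (union_subset hA.1.2.1 hB.1.2.1) hu subset_union_left
    have h2 := hB.2 (A ∪ B) (union_subset hA.1.2.1 hB.1.2.1) hu subset_union_right
    exact hAB (h1.trans h2.symm)

/-- A closed set partitioned into sets with minimal cuts yields an obstruction if its out-degree
has the wrong parity. -/
lemma isObstruction_of_partition {k : ℕ} {D : Digraph V} {C : Finset V} (hC : Cᶜ.Nonempty)
    (hcl : ClosedSet D C) {M : Finset (Finset V)} (hMC : M.biUnion id = C)
    (hdisj : (M : Set (Finset V)).PairwiseDisjoint id)
    (hM : ∀ A ∈ M, A.Nonempty ∧ totalCut D A = 2 * k) {c : ℤ}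
    (hbal : 2 * c = C.card * Cᶜ.card) (hodd : Odd (outCut D C - c)) : IsObstruction k D := by
  refine ⟨M.card, fun i => ((M.equivFin.symm i : Finset V) : Set V), (C : Set V),
    ((Cᶜ : Finset V) : Set V), fun i => ?_, by exact_mod_cast hC, fun i j hij => ?_, ?_, ?_, ?_,
    fun i => ?_, fun x hx y hy => ?_, outCut D C - c, hodd, ?_⟩
  · exact_mod_cast (hM _ (M.equivFin.symm i).2).1
  · rw [disjoint_coe]
    refine hdisj (M.equivFin.symm i).2 (M.equivFin.symm j).2 fun h => hij ?_
    exact M.equivFin.symm.injective (Subtype.ext h)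
  · ext x
    simp only [← hMC, mem_coe, mem_biUnion, id, Set.mem_iUnion]
    constructor
    · rintro ⟨A, hA, hx⟩
      exact ⟨M.equivFin ⟨A, hA⟩, by simpa using hx⟩
    · rintro ⟨i, hx⟩
      exact ⟨_, (M.equivFin.symm i).2, hx⟩
  · rw [disjoint_coe]
    exact disjoint_compl_right
  · rw [← coe_union, union_compl, coe_univ]
  · have h := (hM _ (M.equivFin.symm i).2).2
    rw [← cutSize_coe] at h
    exact_mod_cast h
  · have hx' : x ∈ C := hx
    have hy' : y ∉ C := by simpa using hy
    rw [existsUnique_isLink_iff D (by rintro rfl; exact hy' hx')]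
    exact hcl x hx' y hy'
  · rw [Set.ncard_coe_finset, Set.ncard_coe_finset]
    have hq : ((outDegree D (C : Set V) : ℤ) : ℚ) = outCut D C := by rw [outDegree_coe]
    rw [Int.cast_natCast] at hq
    rw [hq]
    have hbal' : 2 * (c : ℚ) = C.card * Cᶜ.card := by exact_mod_cast hbal
    push_cast
    linarith

/-! ### A closed connected set with few vertices outside. -/

section BigComponent

variable {k p : ℕ} {D : Digraph V} {C : Finset V}

/-- The digraph obtained by removing all arcs outside `C`. -/
def meeting (D : Digraph V) (C : Finset V) : Digraph V := ⟨fun u v => D.Adj u v ∧ (u ∈ C ∨ v ∈ C)⟩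

lemma mult_meeting {u v : V} (h : u ∈ C ∨ v ∈ C) : mult (meeting D C) u v = mult D u v :=
  mult_of_adj_iff (by simp [meeting, h]) (by simp [meeting, h.symm])

lemma mult_meeting_eq_zero {u v : V} (hu : u ∉ C) (hv : v ∉ C) : mult (meeting D C) u v = 0 :=
  mult_eq_zero (by simp [meeting, hu, hv]) (by simp [meeting, hu, hv])

lemma ClosedSet.meeting (hC : ClosedSet D C) : ClosedSet (meeting D C) C := fun u hu v hv => by
  rw [mult_meeting (Or.inl hu), hC u hu v hv]

lemma totalCut_meeting {A : Finset V} (hA : A ⊆ C) :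
    totalCut (Inversions.meeting D C) A = totalCut D A :=
  cutWeight_congr fun _ hu _ _ => mult_meeting (Or.inl (hA hu))

/-- Each vertex of `C` is joined to both `y` and `z`, and one of these two edges crosses `Z`. -/
lemma card_le_totalCut_meeting (hC : ClosedSet D C) {Z : Finset V} {y z : V} (hyZ : y ∈ Z)
    (hzZ : z ∉ Z) (hy : y ∉ C) (hz : z ∉ C) : (C.card : ℤ) ≤ totalCut (meeting D C) Z := by
  have h1 := sum_add_sum_le_cutWeight (mult_nonneg (meeting D C)) hyZ hzZ
  rw [mult_meeting_eq_zero hy hz, add_zero] at h1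
  refine le_trans ?_ h1
  have h2 : (C.card : ℤ) = ∑ u ∈ Z, (if u ∈ C then 1 else 0) + ∑ u ∈ Zᶜ, if u ∈ C then 1 else 0 := by
    rw [sum_add_sum_compl]
    simp
  rw [h2]
  refine add_le_add (sum_le_sum fun u _ => ?_) (sum_le_sum fun u _ => ?_)
  · split_ifs with h
    · rw [hC.meeting u h z hz]
    · exact mult_nonneg _ _ _
  · split_ifs with h
    · rw [mult_comm, hC.meeting u h y hy]
    · exact mult_nonneg _ _ _

lemma largeCuts_meeting (hD : LargeCuts k D) (hC : ClosedSet D C) (hCk : 2 * k + 2 ≤ C.card) :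
    LargeCuts k (meeting D C) := by
  intro Z hZ
  by_cases h : ∃ y ∈ Z, y ∉ C ∧ ∃ z ∉ Z, z ∉ C
  · obtain ⟨y, hyZ, hy, z, hzZ, hz⟩ := h
    have := card_le_totalCut_meeting hC hyZ hzZ hy hz
    omega
  · push Not at h
    have : totalCut (meeting D C) Z = totalCut D Z := cutWeight_congr fun u hu v hv => by
      refine mult_meeting ?_
      by_contra! h'
      exact h'.2 (h u hu h'.1 v hv)
    rw [this]
    exact hD Z hZ

/-- A single arc leaving a closed connected set may be fixed freely if no minimal cut uses it. -/
lemma solvable_of_free_arc (hk : 1 ≤ k) (hp : 2 ≤ p)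
    (hpn : p + 2 ≤ Fintype.card V) (hkn : 4 * k + 2 ≤ Fintype.card V) (hD : LargeCuts k D)
    (hC : ClosedSet D C) (hCk : 2 * k + 2 ≤ C.card) {u y : V} (hu : u ∈ C) (hy : y ∉ C)
    (hmin : ∀ P ⊆ C, P.Nonempty → ClosedSet D P → P = C)
    (hfree : ∀ A ⊆ C, u ∈ A → totalCut D A ≠ 2 * k) : Solvable k p D := by
  have huy : u ≠ y := by rintro rfl; exact hy hu
  set Q : Finset V := {u, y} with hQ
  -- Beyond the arcs outside `C`, the arc between `u` and `y` is deleted, so empty pairs link `C` to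
  -- its complement. The cuts separating `u` from `y` have an edge to spare (`hsep'`).
  let D₁ : Digraph V := ⟨fun a b => (meeting D C).Adj a b ∧ ¬ (a ∈ Q ∧ b ∈ Q)⟩
  have hD0 := largeCuts_meeting hD hC hCk
  have hm : ∀ a b, ¬ (a ∈ Q ∧ b ∈ Q) → mult D₁ a b = mult (meeting D C) a b := by
    intro a b h
    exact mult_of_adj_iff (by simp [D₁, h]) (by simp [D₁, and_comm.not.1 h])
  have hmQ : ∀ a b, a ∈ Q → b ∈ Q → mult D₁ a b = 0 := fun a b h h' =>
    mult_eq_zero (by simp [D₁, h, h']) (by simp [D₁, h, h'])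
  have hmle : ∀ a b, mult D₁ a b ≤ mult (meeting D C) a b := by
    intro a b
    by_cases h : a ∈ Q ∧ b ∈ Q
    · rw [hmQ a b h.1 h.2]
      exact mult_nonneg _ _ _
    · exact (hm a b h).le
  have hsep : ∀ Z, u ∈ Z → y ∉ Z → 2 * (k : ℤ) + 1 ≤ totalCut (meeting D C) Z := by
    intro Z huZ hyZ
    by_cases h : ∃ z ∈ Z, z ∉ C
    · obtain ⟨z, hzZ, hz⟩ := h
      have := card_le_totalCut_meeting hC hzZ hyZ hz hy
      omega
    · push Not at h
      have hZC : Z ⊆ C := fun z hz => h z hz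
      have h1 := hD Z (proper_of_mem huZ hyZ)
      have h2 := hfree Z hZC huZ
      rw [totalCut_meeting hZC]
      omega
  have hsep' : ∀ Z, ¬ (u ∈ Z ↔ y ∈ Z) → 2 * (k : ℤ) + 1 ≤ totalCut (meeting D C) Z := by
    intro Z hZ
    by_cases huZ : u ∈ Z
    · exact hsep Z huZ (by tauto)
    · rw [← totalCut_compl]
      exact hsep Zᶜ (by simpa using huZ) (by simp; tauto)
  have hcut : LargeCuts k D₁ := by
    intro Z hZ
    have h1 := hD0 Z hZ
    have h2 : totalCut (meeting D C) Z ≤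
        cutWeight (fun a b => mult D₁ a b + if a ∈ Q ∧ b ∈ Q then 1 else 0) Z := by
      refine cutWeight_mono fun a ha b hb => ?_
      split_ifs with h
      · rw [hmQ a b h.1 h.2, zero_add]
        have hab : a ≠ b := by rintro rfl; exact hb ha
        simp only [hQ, mem_insert, mem_singleton] at h
        rcases h with ⟨rfl | rfl, rfl | rfl⟩
        · exact absurd rfl hab
        · exact (hC.meeting a hu b hy).le
        · rw [mult_comm]
          exact (hC.meeting b hu a hy).le
        · exact absurd rfl hab
      · rw [hm a b h, add_zero]
    rw [cutWeight_add, cutWeight_ite_mem] at h2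
    have h3 : (Q ∩ Z).card + (Q \ Z).card = 2 := by
      rw [card_inter_add_card_sdiff, hQ, card_pair huy]
    by_cases hZ' : u ∈ Z ↔ y ∈ Z
    · have h4 : (Q ∩ Z).card = 0 ∨ (Q \ Z).card = 0 := by
        by_cases huZ : u ∈ Z
        · right
          rw [card_eq_zero, sdiff_eq_empty_iff_subset]
          intro x hx
          simp only [hQ, mem_insert, mem_singleton] at hx
          rcases hx with rfl | rfl
          · exact huZ
          · exact hZ'.1 huZ
        · left
          rw [card_eq_zero, ← disjoint_iff_inter_eq_empty, disjoint_left]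
          intro x hx
          simp only [hQ, mem_insert, mem_singleton] at hx
          rcases hx with rfl | rfl
          · exact huZ
          · exact fun h => huZ (hZ'.2 h)
      have h5 : ((Q ∩ Z).card : ℤ) * (Q \ Z).card = 0 := by
        rcases h4 with h4 | h4 <;> simp [h4]
      simp only [totalCut] at h1 h2 ⊢
      linarith
    · have h5 : ((Q ∩ Z).card : ℤ) * (Q \ Z).card ≤ 1 := by
        have h6 : (Q ∩ Z).card ≤ 2 := by omega
        have h7 : (Q \ Z).card = 2 - (Q ∩ Z).card := by omega
        rw [h7]
        generalize (Q ∩ Z).card = m at *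
        interval_cases m <;> simp
      have := hsep' Z hZ'
      simp only [totalCut] at this h2 ⊢
      linarith
  refine solvable_of_connected hk hp hpn hkn (D₀ := D₁) (fun a b h => h.1.1) hcut ?_
  rintro P ⟨a, ha⟩ hP
  have hadj : ∀ a ∈ P, ∀ b, mult D₁ a b = 0 → b ∈ P := by
    intro a ha b hab
    by_contra hb
    have := hP a ha b hb
    omega
  have hout : ∀ a b, a ∉ C → b ∉ C → mult D₁ a b = 0 := fun a b h h' =>
    le_antisymm ((hmle a b).trans (mult_meeting_eq_zero h h').le) (mult_nonneg _ _ _)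
  have huyP : u ∈ P ↔ y ∈ P :=
    ⟨fun h => hadj u h y (hmQ u y (by simp [hQ]) (by simp [hQ])),
      fun h => hadj y h u (hmQ y u (by simp [hQ]) (by simp [hQ]))⟩
  have hPC : (P ∩ C).Nonempty → P ∩ C = C := by
    intro hne
    refine hmin _ inter_subset_right hne fun a ha b hb => ?_
    rw [mem_inter] at ha hb
    by_cases hbC : b ∈ C
    · have h1 := hP a ha.1 b (fun h => hb ⟨h, hbC⟩)
      rw [hm, mult_meeting (Or.inl ha.2)] at h1
      · exact h1
      · intro h
        simp only [hQ, mem_insert, mem_singleton] at h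
        have h1 : a ≠ y := by rintro rfl; exact hy ha.2
        have h2 : b ≠ y := by rintro rfl; exact hy hbC
        have h3 : a = u := by tauto
        have h4 : b = u := by tauto
        exact hb ⟨by rw [h4, ← h3]; exact ha.1, hbC⟩
    · exact hC a ha.2 b hbC
  have huP : u ∈ P := by
    by_cases haC : a ∈ C
    · have := hPC ⟨a, mem_inter.2 ⟨ha, haC⟩⟩
      rw [← this] at hu
      exact (mem_inter.1 hu).1
    · exact huyP.2 (hadj a ha y (hout a y haC hy))
  have hCP := hPC ⟨u, mem_inter.2 ⟨huP, hu⟩⟩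
  rw [eq_univ_iff_forall]
  intro v
  by_cases hv : v ∈ C
  · rw [← hCP] at hv
    exact (mem_inter.1 hv).1
  · exact hadj y (huyP.1 huP) v (hout y v hy hv)

/-- If some vertex of `C` lies in no minimal cut inside `C`, `solvable_of_free_arc` applies.
Otherwise minimal cuts partition `C`, every strong reorientation is balanced on `C`, and the absence
of an obstruction makes the number of reversed crossing pairs even. -/
lemma solvable_of_component (hk : 1 ≤ k) (hp : 2 ≤ p)
    (hpn : p + 2 ≤ Fintype.card V) (hkn : 4 * k + 2 ≤ Fintype.card V) (hD : LargeCuts k D)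
    (hC : ClosedSet D C) (hCc : Cᶜ.Nonempty) (hCk : Cᶜ.card ≤ 2 * k)
    (hmin : ∀ P ⊆ C, P.Nonempty → ClosedSet D P → P = C) (hobs : ¬ IsObstruction k D) :
    Solvable k p D := by
  have hcard := card_add_card_compl C
  obtain ⟨y₀, hy₀⟩ := hCc
  rw [mem_compl] at hy₀
  by_cases hcov : ∀ u ∈ C, ∃ A ⊆ C, u ∈ A ∧ totalCut D A = 2 * k
  swap
  · push Not at hcov
    obtain ⟨u, hu, hfree⟩ := hcov
    exact solvable_of_free_arc hk hp hpn hkn hD hC (by omega) hu hy₀ hmin hfree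
  obtain ⟨M, hMC, hMd, hM⟩ := exists_partition hD ⟨y₀, by simpa using hy₀⟩ hcov
  set D₀ := meeting D C with hD₀
  have hsub : ∀ u v, D₀.Adj u v → D.Adj u v := fun u v h => h.1
  obtain ⟨T, q, hT⟩ := exists_potential hp hpn
  obtain ⟨D', hsame, hs⟩ := (largeCuts_meeting hD hC (by omega)).exists_strong
  obtain ⟨f, hf, rfl⟩ := hsame.exists_flip _ _ rfl
  set S := cliqueSpan V p ⊔ edgeSpan (SymPair D₀) with hS
  have hle : cliqueSpan V p ≤ S := le_sup_left
  have hbal : 2 * outCut (flip D₀ f) C = C.card * Cᶜ.card := by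
    have := two_mul_outCut_eq hsame hs (s := M) (P := id)
      (fun A hA => by
        obtain ⟨x, hx⟩ := (hM A hA).1
        exact proper_of_mem (u := x) (v := y₀) hx fun h => hy₀ ((hM A hA).2.1 h)) hMd
      (fun A hA => by
        rw [← (hM A hA).2.2]
        exact totalCut_meeting (hM A hA).2.1) (by rw [hMC]; exact hC.meeting)
    rwa [hMC] at this
  have hcross : crossing C f = 0 := by
    by_contra h
    refine hobs (isObstruction_of_partition ⟨y₀, by simpa using hy₀⟩ hC hMC hMd
      (fun A hA => ⟨(hM A hA).1, (hM A hA).2.2⟩) hbal ?_)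
    have h1 := outCut_flip_cast hC.meeting f
    have h2 : outCut D₀ C = outCut D C := cutWeight_congr fun u hu v _ => by
      simp [arcWeight, hD₀, meeting, hu]
    rw [← hD₀, h2] at h1
    rw [← Int.not_even_iff_odd, ← ZMod.intCast_eq_zero_iff_even, Int.cast_sub, h1]
    simpa using h
  obtain ⟨c₀, hc₀⟩ : C.Nonempty := card_pos.1 (by omega)
  have hclass := potential_class (D₀ := D₀) hT hc₀ fun P hPC hP hcl =>
    hmin P hPC hP fun a ha b hb => by
      by_cases hbC : b ∈ C
      · rw [← hcl a ha b hbC hb, hD₀, mult_meeting (Or.inl hbC |>.symm)]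
      · exact hC a (hPC ha) b hbC
  have hsym : ∀ a b, a ∉ C → b ∉ C → a ≠ b → edge a b ∈ S := by
    intro a b ha hb hab
    refine (le_sup_right : _ ≤ S) (edge_mem_edgeSpan hab ?_)
    rw [symPair_iff, hD₀, mult_meeting_eq_zero ha hb]
    simp
  have hclass' : ∀ y, y ∉ C → q y₀ + q y ∈ S ∨ q y₀ + q y + T ∈ S := by
    intro y hy
    by_cases h : y₀ = y
    · left
      rw [h, add_self_pairs]
      exact zero_mem _
    · right
      convert add_mem (hsym y₀ y hy₀ hy h) (hle (hT y₀ y h)) using 1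
      linear_combination - add_self_pairs (edge y₀ y)
  -- A pair inside or outside `C` has class `0` or `T`; a crossing pair has in addition `q c₀ + q
  -- y₀`, which cancels in `f` because `crossing C f = 0`.
  let z : (Sym2 V → ZMod 2) →+ (Sym2 V → ZMod 2) :=
    AddMonoidHom.mk' (fun g => crossing C g • (q c₀ + q y₀)) fun g h => by
      simp only [map_add, add_smul]
  have hfS := mem_or_of_edgeSpan (S := S) (T := T) z (fun a b hab _ => by
    have hz : z (edge a b) = (if (a ∈ C ↔ b ∈ C) then 0 else 1 : ZMod 2) • (q c₀ + q y₀) := by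
      simp only [z, AddMonoidHom.mk'_apply, crossing_edge C hab]
    rw [hz]
    have h := hle (hT a b hab)
    by_cases ha : a ∈ C <;> by_cases hb : b ∈ C
    · simpa [ha, hb, add_self_pairs] using edge_mem_or h (hclass a ha) (hclass b hb)
    · simpa [ha, hb] using edge_mem_or h (hclass a ha) (hclass' b hb)
    · simpa [ha, hb, add_comm (q y₀)] using edge_mem_or h (hclass' a ha) (hclass b hb)
    · simpa [ha, hb, add_self_pairs] using edge_mem_or h (hclass' a ha) (hclass' b hb)) hf
  have hzf : z f = 0 := by simp [z, hcross]
  rw [hzf, add_zero] at hfS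
  by_cases hTS : T ∈ S
  · refine solvable_of_mem_sup hsub ?_ hs
    rcases hfS with hfS | hfS
    · exact hfS
    · convert add_mem hfS hTS using 1
      linear_combination - add_self_pairs T
  rcases hfS with hfS | hfS
  · exact solvable_of_mem_sup hsub hfS hs
  -- Three vertices outside `C` would span a triangle of free pairs, whose class is `T`.
  have hY2 : Cᶜ.card ≤ 2 := by
    by_contra! h
    obtain ⟨a, b, c, ha, hb, hc, hab, hac, hbc⟩ := two_lt_card_iff.1 h
    rw [mem_compl] at ha hb hc
    have h1 : ∀ a b, a ∉ C → b ∉ C → a ≠ b → T + (q a + q b) ∈ S := by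
      intro a b ha hb hab
      convert add_mem (hsym a b ha hb hab) (hle (hT a b hab)) using 1
      linear_combination - add_self_pairs (edge a b)
    refine hTS ?_
    convert add_mem (add_mem (h1 a b ha hb hab) (h1 b c hb hc hbc)) (h1 a c ha hc hac) using 1
    linear_combination - add_self_pairs T - add_self_pairs (q a) - add_self_pairs (q b) -
      add_self_pairs (q c)
  have hcover : C ⊆ univ.filter (fun a => q c₀ + q a ∈ S) ∪
      univ.filter (fun a => q c₀ + q a + T ∈ S) := by
    rw [← filter_or]
    exact fun a ha => mem_filter.2 ⟨mem_univ a, hclass a ha⟩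
  have hlarge : ∀ m, 2 * m - 1 ≤ C.card →
      ∃ N ⊆ C, m ≤ N.card ∧ ∀ a ∈ N, ∀ b ∈ N, q a + q b ∈ S := by
    intro m hm
    rcases exists_large_class hcover hm with h | h
    · refine ⟨_, inter_subset_left, h, fun a ha b hb => ?_⟩
      simp only [mem_inter, mem_filter, mem_univ, true_and] at ha hb
      convert add_mem ha.2 hb.2 using 1
      linear_combination - add_self_pairs (q c₀)
    · refine ⟨_, inter_subset_left, h, fun a ha b hb => ?_⟩
      simp only [mem_inter, mem_filter, mem_univ, true_and] at ha hb
      convert add_mem ha.2 hb.2 using 1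
      linear_combination - add_self_pairs (q c₀) - add_self_pairs T
  by_cases hbig : 2 * (k + 2) - 1 ≤ C.card
  · obtain ⟨N, -, hN, hNq⟩ := hlarge (k + 2) hbig
    exact solvable_of_class hsub hT hs hfS hN hNq
  -- The bounds now force `k = 1`, `|C| = 4` and `|Cᶜ| = 2`. The tight set `A` containing `a` should
  -- have cut size `2`, but `y`, `z` and `b` provide a third edge whether or not `b ∈ A`.
  exfalso
  obtain ⟨N, hNC, hN, hNq⟩ := hlarge 2 (by omega)
  obtain ⟨a, ha, b, hb, hab⟩ := one_lt_card.1 (by omega : 1 < N.card)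
  obtain ⟨y, z, hy, hz, hyz⟩ := one_lt_card_iff.1 (by omega : 1 < Cᶜ.card)
  rw [mem_compl] at hy hz
  have hmab : mult D₀ a b = 1 := by
    by_contra h
    rw [← ne_eq, ← symPair_iff] at h
    have h1 : edge a b ∈ S := (le_sup_right : _ ≤ S) (edge_mem_edgeSpan hab h)
    refine hTS ?_
    convert add_mem h1 (add_mem (hle (hT a b hab)) (hNq a ha b hb)) using 1
    linear_combination - add_self_pairs (edge a b) - add_self_pairs (q a) - add_self_pairs (q b)
  obtain ⟨A, hAC, haA, hA⟩ := hcov a (hNC ha)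
  have hpair : ∀ {s : Finset V} {g : V → ℤ}, (∀ v, 0 ≤ g v) → ∀ {v w : V}, v ∈ s → w ∈ s →
      v ≠ w → g v + g w ≤ ∑ x ∈ s, g x := by
    intro s g hg v w hv hw hvw
    rw [← sum_pair hvw]
    refine sum_le_sum_of_subset_of_nonneg ?_ fun x _ _ => hg x
    intro x hx
    simp only [mem_insert, mem_singleton] at hx
    rcases hx with rfl | rfl <;> assumption
  have hyA : y ∈ Aᶜ := by simpa using fun h => hy (hAC h)
  have hzA : z ∈ Aᶜ := by simpa using fun h => hz (hAC h)
  have hm1 := hC.meeting a (hNC ha) y hy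
  have hm2 := hC.meeting a (hNC ha) z hz
  have hm3 := hC.meeting b (hNC hb) y hy
  have hle1 := hpair (mult_nonneg D₀ a) hyA hzA hyz
  rw [← totalCut_meeting hAC, ← hD₀] at hA
  rw [← hD₀] at hm1 hm2 hm3
  simp only [totalCut] at hA
  by_cases hbA : b ∈ A
  · have h1 := sum_add_sum_le_cutWeight (mult_nonneg D₀) haA (mem_compl.1 hyA)
    have hle2 := hpair (g := fun u => mult D₀ u y) (fun u => mult_nonneg D₀ u y) haA hbA hab
    omega
  · have h1 := sum_add_sum_le_cutWeight (mult_nonneg D₀) haA hbA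
    have hle2 := single_le_sum (f := fun u => mult D₀ u b) (fun u _ => mult_nonneg D₀ u b) haA
    have hby : b ≠ y := by rintro rfl; exact hy (hNC hb)
    have hbz : b ≠ z := by rintro rfl; exact hz (hNC hb)
    have hsub3 : ({b, y, z} : Finset V) ⊆ Aᶜ := by
      intro x hx
      simp only [mem_insert, mem_singleton] at hx
      rcases hx with rfl | rfl | rfl
      · simpa using hbA
      · exact hyA
      · exact hzA
    have hle3 := sum_le_sum_of_subset_of_nonneg hsub3 fun x _ _ => mult_nonneg D₀ a x
    rw [sum_insert (by simp [hby, hbz]), sum_pair hyz] at hle3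
    omega

end BigComponent

/-! ### Sufficiency: case analysis on a smallest large closed set. -/

theorem solvable_of_not_isObstruction {k p : ℕ} {D : Digraph V} (hk : 1 ≤ k) (hp : 2 ≤ p)
    (hpn : p + 2 ≤ Fintype.card V) (hkn : 4 * k + 2 ≤ Fintype.card V) (hD : LargeCuts k D)
    (hobs : ¬ IsObstruction k D) : Solvable k p D := by
  obtain ⟨X, hX, hXmin⟩ := exists_min_image
    (univ.filter fun X : Finset V => ClosedSet D X ∧ 2 * k + 1 ≤ X.card) card
    ⟨univ, by simp only [mem_filter, mem_univ, true_and, card_univ]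
              exact ⟨fun a _ b hb => absurd (mem_univ b) hb, by omega⟩⟩
  simp only [mem_filter, mem_univ, true_and] at hX hXmin
  obtain ⟨hXcl, hXk⟩ := hX
  have hcard := card_add_card_compl X
  have hXcl' : ∀ u v, ¬ (u ∈ X ↔ v ∈ X) → mult D u v = 1 := by
    intro u v h
    by_cases hu : u ∈ X
    · exact hXcl u hu v (by tauto)
    · rw [mult_comm]
      exact hXcl v (by tauto) u hu
  by_cases hXc : 2 * k + 1 ≤ Xᶜ.card
  · obtain ⟨x, hx⟩ : X.Nonempty := card_pos.1 (by omega)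
    obtain ⟨y, hy⟩ : Xᶜ.Nonempty := card_pos.1 (by omega)
    rw [mem_compl] at hy
    have hxy : x ≠ y := by rintro rfl; exact hy hx
    refine solvable_of_groups hk hp hpn hkn (fun v => v ∈ X) {x, y} (by rw [card_pair hxy]; omega)
      (fun v => ?_) (fun u v h => hXcl' u v fun h' => h (propext h')) fun u => ?_
    · by_cases hv : v ∈ X
      · exact ⟨x, by simp, by simp [hx, hv]⟩
      · exact ⟨y, by simp, by simp [hy, hv]⟩
    · rw [card_pair hxy]
      by_cases hu : u ∈ X
      · exact ⟨Xᶜ, fun v hv => by simpa [hu] using hv, by omega⟩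
      · exact ⟨X, fun v hv => by simpa [hu] using hv, by omega⟩
  by_cases hmin : ∀ P ⊆ X, P.Nonempty → ClosedSet D P → P = X
  · by_cases hXne : Xᶜ.Nonempty
    · exact solvable_of_component hk hp hpn hkn hD hXcl hXne (by omega) hmin hobs
    · rw [not_nonempty_iff_eq_empty, compl_eq_empty_iff] at hXne
      refine solvable_of_connected hk hp hpn hkn (fun _ _ h => h) hD fun P hP hcl => ?_
      rw [← hXne]
      exact hmin P (by rw [hXne]; exact subset_univ P) hP hcl
  push Not at hmin
  obtain ⟨P, hPX, hPne, hPcl, hPX'⟩ := hmin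
  have hPcl' : ∀ u v, ¬ (u ∈ P ↔ v ∈ P) → mult D u v = 1 := by
    intro u v h
    by_cases hu : u ∈ P
    · exact hPcl u hu v (by tauto)
    · rw [mult_comm]
      exact hPcl v (by tauto) u hu
  have hPQ := card_sdiff_add_card_eq_card hPX
  have hPlt : P.card < X.card := card_lt_card (hPX.ssubset_of_ne hPX')
  have hPpos := card_pos.2 hPne
  -- By minimality of `X` neither `P` nor `X \ P`, which is closed too, exceeds `2 * k`. So `P`, `X
  -- \ P` and `Xᶜ` are three groups of size at most `2 * k`, each leaving at least `2 * k + 2`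
  -- vertices outside it.
  have hPk : P.card ≤ 2 * k := by
    by_contra! h
    have := hXmin P ⟨hPcl, by omega⟩
    omega
  have hQk : (X \ P).card ≤ 2 * k := by
    by_contra! h
    have := hXmin (X \ P) ⟨fun a ha b hb => ?_, by omega⟩
    · omega
    · rw [mem_sdiff] at ha hb
      by_cases hbX : b ∈ X
      · exact hPcl' a b (by tauto)
      · exact hXcl a ha.1 b hbX
  obtain ⟨a, ha⟩ := hPne
  obtain ⟨b, hb⟩ : (X \ P).Nonempty := card_pos.1 (by omega)
  obtain ⟨c, hc⟩ : Xᶜ.Nonempty := card_pos.1 (by omega)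
  rw [mem_compl] at hc
  rw [mem_sdiff] at hb
  have haX := hPX ha
  have hcP : c ∉ P := fun h => hc (hPX h)
  have hQ3 : ({a, b, c} : Finset V).card ≤ 3 := card_le_three
  refine solvable_of_groups hk hp hpn hkn (fun v => (v ∈ P, v ∈ X)) {a, b, c} hQ3
    (fun v => ?_) (fun u v h => ?_) fun u => ?_
  · by_cases hvP : v ∈ P
    · exact ⟨a, by simp, by simp [ha, hvP, haX, hPX hvP]⟩
    · by_cases hvX : v ∈ X
      · exact ⟨b, by simp, by simp [hb, hvP, hvX]⟩
      · exact ⟨c, by simp, by simp [hc, hcP, hvP, hvX]⟩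
  · by_cases h1 : u ∈ P ↔ v ∈ P
    · by_cases h2 : u ∈ X ↔ v ∈ X
      · exact absurd (by simp [h1, h2]) h
      · exact hXcl' u v h2
    · exact hPcl' u v h1
  · by_cases huP : u ∈ P
    · have := card_add_card_compl P
      exact ⟨Pᶜ, fun v hv => by simp [mem_compl.1 hv, huP], by omega⟩
    · by_cases huX : u ∈ X
      · have := card_add_card_compl (X \ P)
        refine ⟨(X \ P)ᶜ, fun v hv => ?_, by omega⟩
        simp only [mem_compl, mem_sdiff, not_and, not_not] at hv
        by_cases hvX : v ∈ X
        · simp [hv hvX, huP]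
        · simp [hvX, huX]
      · exact ⟨X, fun v hv => by simp [hv, huX], by omega⟩

end Solving

end Inversions

theorem mainTheorem1 {V : Type*} [Fintype V] (D : Digraph V) (k p : ℕ)
    (hk : 1 ≤ k) (hp : 3 ≤ p) (hodd : Odd p)
    (hn : max (p + 2) (4 * k + 2) ≤ Fintype.card V)
    (hD : Inversions.DigraphEdgeConnected D (2 * k)) :
    Inversions.Invertible k p D ↔ ¬ Inversions.IsObstruction k D := by
  rw [Inversions.invertible_iff_solvable]
  refine ⟨fun h hobs => Inversions.not_solvable_of_isObstruction hodd hobs h, fun h => ?_⟩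
  exact Inversions.solvable_of_not_isObstruction hk (by omega) (le_of_max_le_left hn)
    (le_of_max_le_right hn) (Inversions.largeCuts_of_edgeConnected hD) h
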